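/- Let $d\ge 2$ and let $\mathcal A$ be a finite alphabet. A configuration $x\in\mathcal A^{\mathbb Z^d}$ is strongly periodic if its orbit $\{\sigma^u(x) : u\in\mathbb Z^d\}$ under the shift, $\sigma^u(x)(v)=x(v+u)$, is finite; it is strongly periodic outside a finite region if there are a finite set $C\subset\mathbb Z^d$ and a strongly periodic configuration $z\in\mathcal A^{\mathbb Z^d}$ such that $x(v)=z(v)$ for all $v\notin C$. A subshift is a closed, shift-invariant subset of $\mathcal A^{\mathbb Z^d}$ (for the product of the discrete topologies), and for subshifts $Y,X$, possibly over different alphabets, $Y\hookrightarrow X$ means that there is an injective continuous map $Y\to X$ that commutes with all shifts $\sigma^u$. **Theorem.** Let $Y\subseteq\mathcal A^{\mathbb Z^d}$ be a subshift that contains a configuration that is not strongly periodic, but is strongly periodic outside a finite region. Then the problem $Y\hookrightarrow X$ for SFT inputs is $\Sigma^0_1$-hard. That is, every recursively enumerable set $S\subseteq\mathbb N$ is many-one reducible, by a computable function, to the following decision problem: given a finite alphabet $\{0,\dots,k-1\}$ and a finite list of forbidden patterns over it, does $Y\hookrightarrow X$ hold for the subshift of finite type $X\subseteq\{0,\dots,k-1\}^{\mathbb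 Z^d}$ of all configurations in which no listed pattern occurs? -/

import Mathlib

open SymbolicDynamics.FullShift

/-- A configuration on `ℤ^d` is strongly periodic if its orbit under the shift is finite. -/
def StronglyPeriodic {d : ℕ} {A : Type*} (x : (Fin d → ℤ) → A) : Prop :=
  (Set.range fun u : Fin d → ℤ => shift u x).Finite

/-- A configuration is strongly periodic outside a finite region if there are a finite set `C` of
positions and a strongly periodic configuration that agrees with it at all positions outside `C`. -/
def StronglyPeriodicOutsideFinite {d : ℕ} {A : Type*} (x : (Fin d → ℤ) → A) : Prop :=
  ∃ C : Set (Fin d → ℤ), C.Finite ∧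
    ∃ z : (Fin d → ℤ) → A, StronglyPeriodic z ∧ ∀ v, v ∉ C → x v = z v

/-- A morphism of subshifts: a continuous map that commutes with all shift translations. -/
def IsSubshiftMorphism {d : ℕ} {A B : Type*} [TopologicalSpace A] [TopologicalSpace B]
    (Y : Subshift A (Fin d → ℤ)) (X : Subshift B (Fin d → ℤ))
    (F : Y.carrier → X.carrier) : Prop :=
  Continuous F ∧
    ∀ (u : Fin d → ℤ) (y : Y.carrier),
      F ⟨shift u y.1, Y.mapsTo u y.2⟩ = ⟨shift u (F y).1, X.mapsTo u (F y).2⟩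

/-- `Y ↪ X`: there is an injective morphism from `Y` to `X`. -/
def SubshiftEmbeds {d : ℕ} {A B : Type*} [TopologicalSpace A] [TopologicalSpace B]
    (Y : Subshift A (Fin d → ℤ)) (X : Subshift B (Fin d → ℤ)) : Prop :=
  ∃ F : Y.carrier → X.carrier, IsSubshiftMorphism Y X F ∧ Function.Injective F

/-- A finite presentation of a subshift of finite type on `ℤ^d`: a number `k`, standing for the
alphabet `{0, …, k - 1}`, and a finite list of forbidden patterns. A pattern is given by the finite
list of its pairs (position, symbol). -/
abbrev SFTPresentation (d : ℕ) : Type :=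
  ℕ × List (List ((Fin d → ℤ) × ℕ))

/-- The pattern `p` (a list of pairs of a position and a symbol) occurs in `x` at position `u`.
A list that gives two different symbols to one position, or uses a symbol outside the alphabet,
occurs nowhere, so forbidding it is no restriction. -/
def PatternOccursAt {d k : ℕ} (p : List ((Fin d → ℤ) × ℕ)) (x : (Fin d → ℤ) → Fin k)
    (u : Fin d → ℤ) : Prop :=
  ∀ c ∈ p, (shift u x c.1).val = c.2

/-- The subshift of finite type with a given presentation: all configurations over the alphabet
`{0, …, k - 1}` in which none of the listed forbidden patterns occurs. -/
def SFTPresentation.toSubshift {d : ℕ} (P : SFTPresentation d) :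
    Subshift (Fin P.1) (Fin d → ℤ) where
  carrier := {x | ∀ p ∈ P.2, ∀ u : Fin d → ℤ, ¬ PatternOccursAt p x u}
  isClosed := by
    have h : {x : (Fin d → ℤ) → Fin P.1 | ∀ p ∈ P.2, ∀ u, ¬ PatternOccursAt p x u} =
        ⋂ p ∈ P.2, ⋂ u : Fin d → ℤ, (⋂ c ∈ {c | c ∈ p}, {x | (shift u x c.1).val = c.2})ᶜ := by
      ext x
      simp [PatternOccursAt]
    rw [h]
    refine isClosed_biInter fun p _ => isClosed_iInter fun u => ?_
    rw [isClosed_compl_iff]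
    refine (List.finite_toSet p).isOpen_biInter fun c _ => ?_
    have hc : Continuous fun x : (Fin d → ℤ) → Fin P.1 => shift u x c.1 :=
      continuous_apply (u + c.1)
    exact (isOpen_discrete {a : Fin P.1 | (a : ℕ) = c.2}).preimage hc
  mapsTo := by
    intro g x hx p hp u hu
    refine hx p hp (g + u) ?_
    intro c hc
    rw [shift_add]
    exact hu c hc

/-- The decision problem `Y ↪ X` for SFT inputs, with fixed parameter `Y`: on input a presentation
of an SFT `X`, decide whether `Y` embeds into `X`. -/
def EmbeddingProblem {d : ℕ} {A : Type*} [TopologicalSpace A] (Y : Subshift A (Fin d → ℤ)) :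
    SFTPresentation d → Prop :=
  fun P => SubshiftEmbeds Y P.toSubshift

/-- A decision problem is `Σ⁰₁`-hard if every `Σ⁰₁` (recursively enumerable) set of natural numbers
is many-one reducible to it by a computable function. -/
def IsSigmaZeroOneHard {α : Type*} [Primcodable α] (p : α → Prop) : Prop :=
  ∀ q : ℕ → Prop, REPred q → q ≤₀ p

/-! Let `y` in `Y` be not strongly periodic but equal, off a finite set, to a configuration `z` with
period `p` along every axis, and let `M` be a row automaton whose halting set is the given r.e. set.
For input `n` the SFT has two layers. The first is an arbitrary configuration over `A`; a break is a
position where it fails to be `p`-periodic. The second layer may be blank only off the breaks, and a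
nonblank cell needs a break nearby or must differ from one of its four translates by `p` in a
coordinate plane. Lower left corners of the nonblank region are marked, and marks continue to the
right or downwards until they reach the corner of a space-time diagram of `M` on input `n`.

An embedding forces halting (`halts_of_subshiftEmbeds`). The limit `z` of shifts of `y` lies in `Y`,
and its image is `p`-periodic, so has a blank second layer. The image of `y` differs from it at
finitely many positions, so its second layer has finite support. That support is nonempty: otherwise
the image, and by injectivity `y`, would be `p`-periodic. The marks then lead to a diagram with
finite support, which exists only if `M` halts (`RowAutomaton.halts_of_finite`).

If `M` halts, every `Y` embeds by `x ↦ (x, Φ x)`, where `Φ` is a local function of the breaks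
(`cellRule_cellLayer`, `cellLayer_congr`). Nonblank cells are those within distance `R` of a break
in their plane, with `R` larger than the halting diagram; the distance to the nearest break modulo
`p + 1` provides the aperiodicity; diagrams stand at selected, well separated corners. -/

/-- A deterministic automaton acting on one-sided infinite rows of symbols. In one step, every cell
is rewritten by a rule that sees the state, the symbol in cell `0`, and the symbols in the cell and
its two neighbours. -/
structure RowAutomaton (Q S : Type) where
  /-- the initial state -/
  start : Q
  /-- the symbol of an unused cell -/
  blank : S
  /-- the next state, if any, as a function of the state and the symbol in cell `0` -/
  next : Q → S → Option Q
  /-- the rewriting rule; the third argument is `none` in cell `0` -/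
  update : Q → S → Option S → S → S → S
  update_blank : ∀ q a, update q a (some blank) blank blank = blank

/-! ### Runs of row automata -/

namespace RowAutomaton

variable {Q S : Type} (M : RowAutomaton Q S)

/-- The left neighbour of a cell in a row. -/
def leftOf (s : ℕ → S) : ℕ → Option S
  | 0 => none
  | i + 1 => some (s i)

/-- The row obtained from `s` in one step. -/
def nextRow (q : Q) (s : ℕ → S) (i : ℕ) : S :=
  M.update q (s 0) (leftOf s i) (s i) (s (i + 1))

/-- One step of the automaton. -/
def step (c : Q × (ℕ → S)) : Option (Q × (ℕ → S)) :=
  (M.next c.1 (c.2 0)).map fun q => (q, M.nextRow c.1 c.2)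

/-- The automaton halts when started in the given configuration. -/
def Halts (c : Q × (ℕ → S)) : Prop :=
  (StateTransition.eval M.step c).Dom

theorem exists_trace_of_reaches {σ : Type*} {f : σ → Option σ} {a b : σ}
    (h : StateTransition.Reaches f a b) :
    ∃ (t : ℕ) (r : ℕ → σ), r 0 = a ∧ r t = b ∧ ∀ j < t, f (r j) = some (r (j + 1)) := by
  induction h with
  | refl => exact ⟨0, fun _ => a, rfl, rfl, by simp⟩
  | @tail b c _ hbc ih =>
    obtain ⟨t, r, h0, ht, hs⟩ := ih
    refine ⟨t + 1, fun j => if j ≤ t then r j else c, by simpa using h0, by simp, fun j hj => ?_⟩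
    rcases Nat.lt_succ_iff_lt_or_eq.1 hj with hj | rfl
    · simp [hj.le, Nat.succ_le_of_lt hj, hs j hj]
    · simpa [ht] using hbc

variable {M}

theorem Halts.exists_trace {c : Q × (ℕ → S)} (h : M.Halts c) :
    ∃ (t : ℕ) (r : ℕ → Q × (ℕ → S)), r 0 = c ∧ M.next (r t).1 ((r t).2 0) = none ∧
      ∀ j < t, M.step (r j) = some (r (j + 1)) := by
  obtain ⟨b, hb⟩ := Part.dom_iff_mem.1 h
  rw [StateTransition.mem_eval] at hb
  obtain ⟨t, r, h0, ht, hs⟩ := exists_trace_of_reaches hb.1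
  exact ⟨t, r, h0, by simpa [step, ht] using hb.2, hs⟩

theorem exists_trace_of_not_halts {c : Q × (ℕ → S)} (h : ¬ M.Halts c) :
    ∃ r : ℕ → Q × (ℕ → S), r 0 = c ∧ ∀ j, M.step (r j) = some (r (j + 1)) := by
  have key : ∀ b, StateTransition.Reaches M.step c b → ∃ b', M.step b = some b' := by
    intro b hb
    by_contra hn
    refine h (Part.dom_iff_mem.2 ⟨b, StateTransition.mem_eval.2 ⟨hb, ?_⟩⟩)
    exact Option.eq_none_iff_forall_ne_some.2 fun b' hb' => hn ⟨b', hb'⟩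
  let r : ℕ → {b // StateTransition.Reaches M.step c b} := fun j =>
    Nat.rec ⟨c, Relation.ReflTransGen.refl⟩
      (fun _ b => ⟨(key b.1 b.2).choose, b.2.tail (key b.1 b.2).choose_spec⟩) j
  exact ⟨fun j => (r j).1, rfl, fun j => (key (r j).1 (r j).2).choose_spec⟩

/-- Along a terminating run started in an eventually blank row, only a bounded number of cells is
used. -/
theorem exists_bound_of_trace {t : ℕ} {r : ℕ → Q × (ℕ → S)}
    (hs : ∀ j < t, M.step (r j) = some (r (j + 1))) {n : ℕ}
    (hn : ∀ i, n ≤ i → (r 0).2 i = M.blank) :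
    ∀ j ≤ t, ∀ i, n + t ≤ i → (r j).2 i = M.blank := by
  -- The used part of the row grows by at most one cell per step.
  have key : ∀ j ≤ t, ∀ i, n + j ≤ i → (r j).2 i = M.blank := by
    intro j
    induction j with
    | zero => intro _ i hi; exact hn i hi
    | succ j ih =>
      intro hj i hi
      have h := hs j hj
      simp only [step, Option.map_eq_some_iff] at h
      obtain ⟨q, -, h⟩ := h
      rw [← h]
      obtain ⟨i, rfl⟩ : ∃ k, i = k + 1 := ⟨i - 1, by omega⟩
      simp only [nextRow, leftOf]
      rw [ih (by omega) i (by omega), ih (by omega) (i + 1) (by omega),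
        ih (by omega) (i + 1 + 1) (by omega), M.update_blank]
  exact fun j hj i hi => key j hj i (by omega)

/-- Restriction of a row automaton to a finite set of states. -/
noncomputable def restrict (M : RowAutomaton Q S) (T : Set Q) (hT : M.start ∈ T) : RowAutomaton T S where
  start := ⟨M.start, hT⟩
  blank := M.blank
  next q a := open scoped Classical in
    (M.next q a).bind fun q' => if h : q' ∈ T then some ⟨q', h⟩ else none
  update q := M.update q
  update_blank q := M.update_blank q

/-- Passing to a finite closed set of states does not change halting; it is needed to make the tile
alphabet finite. -/
theorem halts_restrict_iff {T : Set Q} (hT : M.start ∈ T)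
    (hc : ∀ q ∈ T, ∀ a, ∀ q' ∈ M.next q a, q' ∈ T) (s : ℕ → S) :
    (M.restrict T hT).Halts ((M.restrict T hT).start, s) ↔ M.Halts (M.start, s) := by
  symm
  refine StateTransition.tr_eval_dom (f₁ := (M.restrict T hT).step) (f₂ := M.step)
    (tr := fun c c' => c' = (c.1.1, c.2)) ?_ rfl
  rintro ⟨⟨q, hq⟩, s⟩ _ rfl
  rcases h : M.next q (s 0) with _ | q'
  · simp [step, restrict, h]
  · have hq' : q' ∈ T := hc q hq _ q' h
    have : (M.restrict T hT).step (⟨q, hq⟩, s) = some (⟨q', hq'⟩, M.nextRow q s) := by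
      simp [step, restrict, h, hq']
      rfl
    rw [this]
    exact ⟨_, rfl, Relation.TransGen.single (by simp [step, h])⟩

end RowAutomaton

/-! ### Simulation of stack machines -/

namespace RowAutomaton

open Turing StateTransition

section StackMachine

variable {K Γ Λ σ : Type} [DecidableEq K] (m : Λ → TM2.Stmt (fun _ : K => Γ) Λ σ)

/-- The row automaton that executes a stack machine one statement at a time: cell `i` holds the
`i`-th elements of all stacks. -/
def ofStackMachine (start : Λ) (v₀ : σ) :
    RowAutomaton (Option (TM2.Stmt (fun _ : K => Γ) Λ σ) × σ) (K → Option Γ) where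
  start := (some (m start), v₀)
  blank := fun _ => none
  next
    | (none, _), _ => none
    | (some (.push _ _ q), v), _ => some (some q, v)
    | (some (.peek k f q), v), a => some (some q, f v (a k))
    | (some (.pop k f q), v), a => some (some q, f v (a k))
    | (some (.load f q), v), _ => some (some q, f v)
    | (some (.branch f q₁ q₂), v), _ => some (some (cond (f v) q₁ q₂), v)
    | (some (.goto l), v), _ => some (some (m (l v)), v)
    | (some .halt, v), _ => some (none, v)
  update
    | (some (.push k f _), v), _, l, s, _ =>
      Function.update s k (l.elim (some (f v)) fun l => l k)
    | (some (.pop k _ _), _), _, _, s, r => Function.update s k (r k)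
    | _, _, _, s, _ => s
  update_blank := by
    intro q a
    split <;> simp

/-- The row that holds the given stacks. -/
def rowOfStacks (T : K → List Γ) (i : ℕ) (k : K) : Option Γ := (T k)[i]?

/-- The configuration of the row automaton that corresponds to one of the stack machine. -/
def ofStackCfg (c : TM2.Cfg (fun _ : K => Γ) Λ σ) :
    (Option (TM2.Stmt (fun _ : K => Γ) Λ σ) × σ) × (ℕ → K → Option Γ) :=
  ((c.l.map m, c.var), rowOfStacks c.stk)

omit [DecidableEq K] in
theorem rowOfStacks_zero (T : K → List Γ) (k : K) : rowOfStacks T 0 k = (T k).head? := by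
  simp [rowOfStacks, List.head?_eq_getElem?]

/-- One machine step runs a whole nested statement, while the automaton spends one step per
instruction. The tops of all stacks are in cell `0`, so a push or pop moves one track by one cell.
-/
theorem reaches₁_stepAux (start : Λ) (v₀ : σ) (q : TM2.Stmt (fun _ : K => Γ) Λ σ) (v : σ)
    (T : K → List Γ) :
    Reaches₁ (ofStackMachine m start v₀).step ((some q, v), rowOfStacks T)
      (ofStackCfg m (TM2.stepAux q v T)) := by
  induction q generalizing v T with
  | push k f q ih =>
    refine Relation.TransGen.head ?_ (ih v _)
    simp only [step, ofStackMachine, Option.map_some, Option.mem_def, Option.some.injEq,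
      Prod.mk.injEq, true_and]
    ext i j
    rcases i with _ | i <;> by_cases h : j = k
    · subst h; simp [nextRow, leftOf, rowOfStacks]
    · simp [nextRow, leftOf, rowOfStacks, h]
    · subst h; simp [nextRow, leftOf, rowOfStacks]
    · simp [nextRow, leftOf, rowOfStacks, h]
  | peek k f q ih =>
    refine Relation.TransGen.head ?_ (ih _ T)
    simp [step, ofStackMachine, rowOfStacks_zero]
    rfl
  | pop k f q ih =>
    refine Relation.TransGen.head ?_ (ih _ _)
    simp only [step, ofStackMachine, Option.map_some, Option.mem_def, Option.some.injEq,
      Prod.mk.injEq, true_and, rowOfStacks_zero]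
    ext i j
    by_cases h : j = k
    · subst h; simp [nextRow, rowOfStacks]
    · simp [nextRow, rowOfStacks, h]
  | load f q ih =>
    refine Relation.TransGen.head ?_ (ih _ T)
    simp [step, ofStackMachine]
    rfl
  | branch f q₁ q₂ ih₁ ih₂ =>
    simp only [TM2.stepAux]
    cases h : f v with
    | true =>
      refine Relation.TransGen.head ?_ (ih₁ v T)
      simp [step, ofStackMachine, h]
      rfl
    | false =>
      refine Relation.TransGen.head ?_ (ih₂ v T)
      simp [step, ofStackMachine, h]
      rfl
  | goto l =>
    refine Relation.TransGen.single ?_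
    simp [step, ofStackMachine, ofStackCfg]
    rfl
  | halt =>
    refine Relation.TransGen.single ?_
    simp [step, ofStackMachine, ofStackCfg]
    rfl

theorem halts_ofStackMachine_iff (start : Λ) (v₀ : σ) (T : K → List Γ) :
    (ofStackMachine m start v₀).Halts ((ofStackMachine m start v₀).start, rowOfStacks T) ↔
      (eval (TM2.step m) ⟨some start, v₀, T⟩).Dom := by
  refine tr_eval_dom (f₁ := TM2.step m) (f₂ := (ofStackMachine m start v₀).step)
    (tr := fun c c' => c' = ofStackCfg m c) ?_ rfl
  rintro ⟨_ | l, v, T⟩ _ rfl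
  · simp [step, ofStackMachine, ofStackCfg]
  · exact ⟨_, rfl, reaches₁_stepAux m start v₀ (m l) v T⟩

omit [DecidableEq K] in
theorem some_mem_stmts {F : Finset Λ} {l : Λ} (hl : l ∈ F) : some (m l) ∈ TM2.stmts m F := by
  classical
  simp only [TM2.stmts, Finset.some_mem_insertNone, Finset.mem_biUnion]
  exact ⟨l, hl, TM2.stmts₁_self⟩

theorem next_ofStackMachine_mem_stmts [Inhabited Λ] {F : Finset Λ} (hF : TM2.Supports m F)
    (start : Λ) (v₀ : σ) (q : Option (TM2.Stmt (fun _ : K => Γ) Λ σ) × σ)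
    (hq : q.1 ∈ TM2.stmts m F) (a : K → Option Γ) (q' : _)
    (h : q' ∈ (ofStackMachine m start v₀).next q a) : q'.1 ∈ TM2.stmts m F := by
  classical
  obtain ⟨_ | q, v⟩ := q
  · simp [ofStackMachine] at h
  have sub := fun q₁ (h : q₁ ∈ TM2.stmts₁ q) => TM2.stmts_trans h hq
  cases q with
  | goto l =>
    simp only [ofStackMachine, Option.mem_def, Option.some.injEq] at h
    subst h
    exact some_mem_stmts m (TM2.stmts_supportsStmt hF hq v)
  | halt =>
    simp only [ofStackMachine, Option.mem_def, Option.some.injEq] at h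
    subst h
    simp [TM2.stmts]
  | branch f q₁ q₂ =>
    simp only [ofStackMachine, Option.mem_def, Option.some.injEq] at h
    subst h
    refine sub _ ?_
    cases f v <;> simp [TM2.stmts₁, TM2.stmts₁_self]
  | _ =>
    simp only [ofStackMachine, Option.mem_def, Option.some.injEq] at h
    subst h
    refine sub _ ?_
    simp [TM2.stmts₁, TM2.stmts₁_self]

end StackMachine

end RowAutomaton

/-! ### Binary input and r.e. sets -/

section Input

open Turing PartrecToTM2

/-- The `i`-th symbol in the encoding of the input `n` on a stack: `0` and `1` are the binary
digits of `n`, least significant first, `2` is the end mark and `3` is for unused cells. -/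
def inputDigit (n i : ℕ) : Fin 4 :=
  if n / 2 ^ i ≠ 0 then (if n / 2 ^ i % 2 = 0 then 0 else 1)
  else if i = 0 ∨ n / 2 ^ (i - 1) ≠ 0 then 2 else 3

theorem inputDigit_of_lt {n i : ℕ} (h : n < i) : inputDigit n i = 3 := by
  have h1 : n / 2 ^ i = 0 := Nat.div_eq_of_lt (h.trans Nat.lt_two_pow_self)
  have h2 : n / 2 ^ (i - 1) = 0 :=
    Nat.div_eq_of_lt ((Nat.le_sub_one_of_lt h).trans_lt Nat.lt_two_pow_self)
  simp [inputDigit, h1, h2, show i ≠ 0 by omega]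

/-- This makes the input row obey the tile rule that blanks propagate to the right in the bottom
row. -/
theorem inputDigit_succ {n i : ℕ} (h : inputDigit n i = 3) : inputDigit n (i + 1) = 3 := by
  have h1 : n / 2 ^ i = 0 := by
    by_contra h1
    rw [inputDigit, if_pos h1] at h
    split_ifs at h <;> simp at h
  have h2 : n / 2 ^ (i + 1) = 0 := by
    rw [pow_succ, ← Nat.div_div_eq_div_mul, h1, Nat.zero_div]
  simp [inputDigit, h1, h2]

theorem primrec_inputDigit : Primrec₂ inputDigit := by
  have hpow : Primrec₂ fun n i : ℕ => n / 2 ^ i :=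
    Primrec.nat_div.comp Primrec.fst
      ((Primrec.nat_rec₁ 1 (Primrec.nat_mul.comp (Primrec.const 2) Primrec.snd).to₂).comp
        Primrec.snd) |>.of_eq fun ⟨n, i⟩ => by
          simp only
          congr 1
          induction i with
          | zero => rfl
          | succ i ih => rw [pow_succ, ← ih]; simp [mul_comm]
  have hprev : Primrec₂ fun n i : ℕ => n / 2 ^ (i - 1) :=
    hpow.comp₂ Primrec₂.left (Primrec.pred.comp Primrec.snd)
  refine Primrec.ite (PrimrecPred.not (Primrec.eq.comp hpow (Primrec.const 0)))
    (Primrec.ite (Primrec.eq.comp (Primrec.nat_mod.comp hpow (Primrec.const 2)) (Primrec.const 0))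
      (Primrec.const 0) (Primrec.const 1))
    (Primrec.ite (PrimrecPred.or (Primrec.eq.comp Primrec.snd (Primrec.const 0))
      (PrimrecPred.not (Primrec.eq.comp hprev (Primrec.const 0))))
      (Primrec.const 2) (Primrec.const 3))

/-- The stack symbol of a digit. -/
def stackSymbol : Fin 4 → Option Γ'
  | 0 => some Γ'.bit0
  | 1 => some Γ'.bit1
  | 2 => some Γ'.cons
  | 3 => none

theorem trNat_of_pos {n : ℕ} (hn : n ≠ 0) :
    trNat n = (if n % 2 = 0 then Γ'.bit0 else Γ'.bit1) :: trNat (n / 2) := by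
  have hnat : ∀ m : Num, m ≠ 0 → trNum m =
      (if (m : ℕ) % 2 = 0 then Γ'.bit0 else Γ'.bit1) :: trNum (((m : ℕ) / 2 : ℕ) : Num) := by
    intro m hm
    rcases m with _ | m
    · exact absurd rfl hm
    rcases m with _ | m | m
    · rfl
    · have h2 : ((m.bit1 : ℕ)) = 2 * (m : ℕ) + 1 := by simp [PosNum.cast_bit1, two_mul]
      have h3 : (2 * (m : ℕ) + 1) / 2 = m := by omega
      simp [trNum, trPosNum, h2, h3, Nat.add_mod]
    · have h2 : ((m.bit0 : ℕ)) = 2 * (m : ℕ) := by simp [PosNum.cast_bit0, two_mul]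
      simp [trNum, trPosNum, h2]
  have := hnat (n : Num) (by exact_mod_cast hn)
  simpa [trNat] using this

theorem trList_getElem? (n i : ℕ) : (trList [n])[i]? = stackSymbol (inputDigit n i) := by
  induction i generalizing n with
  | zero =>
    rcases eq_or_ne n 0 with rfl | hn
    · simp [trList, inputDigit, stackSymbol]
    · simp only [trList, trNat_of_pos hn, inputDigit]
      by_cases h : n % 2 = 0 <;> simp [hn, h, stackSymbol]
  | succ i ih =>
    rcases eq_or_ne n 0 with rfl | hn
    · simp [trList, inputDigit, stackSymbol]
    · have h1 : (trList [n])[i + 1]? = (trList [n / 2])[i]? := by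
        simp [trList, trNat_of_pos hn]
      have h2 : ∀ j, n / 2 ^ (j + 1) = n / 2 / 2 ^ j := fun j => by
        rw [Nat.div_div_eq_div_mul, pow_succ']
      rw [h1, ih]
      congr 1
      unfold inputDigit
      rw [h2]
      rcases i with _ | i
      · simp [hn]
      · simp [h2]

/-- Every recursively enumerable set is the halting set of a finite row automaton, where the input
is given in binary. -/
theorem REPred.exists_rowAutomaton {P : ℕ → Prop} (hP : REPred P) :
    ∃ (Q S : Type) (_ : Finite Q) (_ : Finite S) (M : RowAutomaton Q S) (γ : Fin 4 → S),
      γ.Injective ∧ γ 3 = M.blank ∧ ∀ n, P n ↔ M.Halts (M.start, fun i => γ (inputDigit n i)) := by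
  -- A partial function with constant value `0` and domain `P`: its code terminates exactly on `P`.
  have h1 : Partrec fun n : ℕ => (Part.assert (P n) fun _ => Part.some ()).map fun _ => 0 :=
    hP.map (Computable.const 0).to₂
  obtain ⟨c, hc⟩ := ToPartrec.Code.exists_code (Nat.Partrec'.part_iff₁.2 h1)
  have hdom : ∀ n, P n ↔ (StateTransition.eval (TM2.step tr) (init c [n])).Dom := by
    intro n
    rw [show StateTransition.eval (TM2.step tr) (init c [n]) = _ from tr_eval c [n]]
    change P n ↔ (c.eval [n]).Dom
    rw [show c.eval [n] = _ from hc (n ::ᵥ List.Vector.nil)]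
    simp [Part.assert]
  let _ : Inhabited Λ' := ⟨trNormal c Cont'.halt⟩
  have hsupp : TM2.Supports tr (codeSupp c Cont'.halt) := tr_supports c Cont'.halt
  have : Finite K' := .of_injective (fun k : K' => match k with
    | .main => (0 : Fin 4) | .rev => 1 | .aux => 2 | .stack => 3) (by
      rintro (_ | _ | _ | _) (_ | _ | _ | _) <;> simp)
  let M := RowAutomaton.ofStackMachine tr (trNormal c Cont'.halt) none
  let T : Set (Option (TM2.Stmt (fun _ : K' => Γ') Λ' (Option Γ')) × Option Γ') :=
    {q | q.1 ∈ TM2.stmts tr (codeSupp c Cont'.halt)}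
  have hTf : T.Finite := by
    refine Set.Finite.subset
      ((TM2.stmts tr (codeSupp c Cont'.halt)).finite_toSet.prod (Set.finite_univ)) ?_
    intro q hq
    exact ⟨hq, Set.mem_univ _⟩
  have hstart : M.start ∈ T := by
    exact RowAutomaton.some_mem_stmts tr hsupp.1
  refine ⟨T, K' → Option Γ', hTf.to_subtype, inferInstance, M.restrict T hstart,
    fun x => Function.update (fun _ => none) K'.main (stackSymbol x), ?_, ?_, fun n => ?_⟩
  · intro a b hab
    have := congrFun hab K'.main
    fin_cases a <;> fin_cases b <;> simp_all [stackSymbol]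
  · exact Function.update_eq_self _ _
  · have hrow : (fun i => Function.update (fun _ : K' => (none : Option Γ')) K'.main
        (stackSymbol (inputDigit n i))) =
        RowAutomaton.rowOfStacks (K'.elim (trList [n]) [] [] []) := by
      ext i k
      cases k <;> simp [RowAutomaton.rowOfStacks, K'.elim, ← trList_getElem?]
    rw [hdom n, hrow, RowAutomaton.halts_restrict_iff hstart
      (fun q hq a q' h => RowAutomaton.next_ofStackMachine_mem_stmts tr hsupp _ _ q hq a q' h)]
    exact (RowAutomaton.halts_ofStackMachine_iff tr _ _ _).symm

end Input

/-! ### Local rules; finite tilings force halting -/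

/-- A tile of the space-time diagrams of a row automaton. It records whether the tile is in the
leftmost column and whether it is in the bottom row, the state, the symbol in cell `0`, and the
symbol in the present cell. -/
structure Tile (Q S : Type) where
  left : Bool
  bottom : Bool
  state : Q
  head : S
  sym : S

instance {Q S : Type} [Finite Q] [Finite S] : Finite (Tile Q S) :=
  .of_injective (fun τ : Tile Q S => (τ.left, τ.bottom, τ.state, τ.head, τ.sym)) (by
    rintro ⟨⟩ ⟨⟩ h
    simpa using h)

/-- The local rule, at the origin, for partial tilings of the plane by space-time diagrams. -/
structure TileRule {Q S : Type} (M : RowAutomaton Q S) (t : ℤ → ℤ → Option (Tile Q S)) : Prop where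
  head_eq : ∀ τ ∈ t 0 0, τ.left = true → τ.head = τ.sym
  state_eq : ∀ τ ∈ t 0 0, τ.bottom = true → τ.state = M.start
  right : ∀ τ ∈ t 0 0, ∀ τ' ∈ t 1 0, τ'.left = false ∧ τ'.bottom = τ.bottom ∧ τ'.state = τ.state ∧
    τ'.head = τ.head ∧ (τ.bottom = true → τ.sym = M.blank → τ'.sym = M.blank)
  blank_of_last : ∀ τ ∈ t 0 0, t 1 0 = none → τ.sym = M.blank
  above : ∀ τ ∈ t 0 0, ∀ q ∈ M.next τ.state τ.head, ∃ τ' ∈ t 0 1, τ'.left = τ.left ∧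
    τ'.bottom = false ∧ τ'.state = q ∧ τ'.sym = M.update τ.state τ.head
      ((t (-1) 0).map Tile.sym) τ.sym (((t 1 0).map Tile.sym).getD M.blank)
  below : ∀ τ ∈ t 0 0, τ.bottom = false → t 0 (-1) ≠ none

/-- The field `f`, seen from `(x, y)`. -/
abbrev viewFrom {α : Type*} (f : ℤ → ℤ → α) (x y : ℤ) : ℤ → ℤ → α :=
  fun a b => f (x + a) (y + b)

section Soundness

variable {Q S : Type} {M : RowAutomaton Q S} {t : ℤ → ℤ → Option (Tile Q S)}

/-- Row `j` of the field `t`, from column `0` on, is a finite piece of the given configuration. -/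
def RowEncodes (M : RowAutomaton Q S) (t : ℤ → ℤ → Option (Tile Q S)) (j : ℕ)
    (c : Q × (ℕ → S)) : Prop :=
  ∃ w : ℕ, 0 < w ∧
    (∀ i < w, t i j = some ⟨decide (i = 0), decide (j = 0), c.1, c.2 0, c.2 i⟩) ∧
    t w j = none ∧ ∀ i, w ≤ i → c.2 i = M.blank

/-- The width stays fixed: a tile marked `left` has no left neighbour, and a tile off the bottom row
needs a tile below it, so the upper row cannot extend past column `w`. The last symbol is blank, so
reading the missing right neighbour as blank loses nothing and the cells beyond stay blank. The head
symbol is copied along the row from column `0`. -/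
theorem RowEncodes.succ (ht : ∀ x y, TileRule M (viewFrom t x y)) {j : ℕ} {c c' : Q × (ℕ → S)}
    (h : RowEncodes M t j c) (hs : M.step c = some c') : RowEncodes M t (j + 1) c' := by
  obtain ⟨w, hw, hrow, hend, hblank⟩ := h
  simp only [RowAutomaton.step, Option.map_eq_some_iff] at hs
  obtain ⟨q, hq, rfl⟩ := hs
  have hlast : c.2 (w - 1) = M.blank := by
    refine (ht (w - 1 : ℕ) j).blank_of_last _ (by simpa [viewFrom] using hrow (w - 1) (by omega)) ?_
    simpa [viewFrom, show ((w - 1 : ℕ) : ℤ) + 1 = w by omega] using hend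
  have hleft : t (-1) j = none := by
    by_contra hne
    obtain ⟨τ, hτ⟩ := Option.ne_none_iff_exists'.1 hne
    have := ((ht (-1) j).right τ (by simpa [viewFrom] using hτ) _
      (by simpa [viewFrom] using hrow 0 hw)).1
    simp at this
  have hup : ∀ i < w, ∃ τ, t i (j + 1) = some τ ∧ τ.left = decide (i = 0) ∧ τ.bottom = false ∧
      τ.state = q ∧ τ.sym = M.nextRow c.1 c.2 i := by
    intro i hi
    obtain ⟨τ, hτ, h1, h2, h3, h4⟩ :=
      (ht i j).above _ (by simpa [viewFrom] using hrow i hi) q hq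
    refine ⟨τ, by simpa [viewFrom] using hτ, h1, h2, h3, ?_⟩
    rw [h4, RowAutomaton.nextRow]
    congr 1
    · rcases i with _ | i
      · simp [viewFrom, RowAutomaton.leftOf, hleft]
      · have := hrow i (by omega)
        simp [viewFrom, RowAutomaton.leftOf, this]
    · rcases Nat.lt_or_ge (i + 1) w with h | h
      · have := hrow (i + 1) h
        push_cast at this
        simp [viewFrom, this]
      · obtain rfl : i + 1 = w := by omega
        push_cast at hend
        simp [viewFrom, hend, hblank]
  have hhead : ∀ i < w, ∀ τ, t i (j + 1) = some τ → τ.head = M.nextRow c.1 c.2 0 := by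
    intro i
    induction i with
    | zero =>
      intro hi τ hτ
      obtain ⟨τ', hτ', h1, -, -, h4⟩ := hup 0 hi
      obtain rfl : τ' = τ := Option.some.inj (hτ'.symm.trans hτ)
      rw [← h4]
      exact (ht 0 (j + 1)).head_eq _ (by simpa [viewFrom] using hτ) (by simp [h1])
    | succ i ih =>
      intro hi τ hτ
      obtain ⟨τ', hτ', -⟩ := hup i (by omega)
      rw [← ih (by omega) τ' hτ']
      exact ((ht i (j + 1)).right τ' (by simpa [viewFrom] using hτ') τ
        (by simpa [viewFrom] using hτ)).2.2.2.1
  refine ⟨w, hw, fun i hi => ?_, ?_, fun i hi => ?_⟩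
  · obtain ⟨τ, hτ, h1, h2, h3, h4⟩ := hup i hi
    have h5 := hhead i hi τ hτ
    push_cast
    rw [hτ]
    obtain ⟨⟩ := τ
    simp_all
  · by_contra hne
    obtain ⟨τ, hτ⟩ := Option.ne_none_iff_exists'.1 hne
    push_cast at hτ
    obtain ⟨τ', hτ', -, h2, -⟩ := hup (w - 1) (by omega)
    have hb := ((ht (w - 1 : ℕ) (j + 1)).right τ' (by simpa [viewFrom] using hτ') τ
      (by simpa [viewFrom, show ((w - 1 : ℕ) : ℤ) + 1 = w by omega] using hτ)).2.1
    refine (ht w (j + 1)).below τ (by simpa [viewFrom] using hτ) (hb.trans h2) ?_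
    simpa [viewFrom] using hend
  · have h1 : RowAutomaton.leftOf c.2 i = some M.blank := by
      obtain ⟨i, rfl⟩ : ∃ k, i = k + 1 := ⟨i - 1, by omega⟩
      rcases eq_or_lt_of_le hi with h | h
      · simpa [RowAutomaton.leftOf, h] using hlast
      · simpa [RowAutomaton.leftOf] using hblank i (by omega)
    simp only [RowAutomaton.nextRow]
    rw [h1, hblank i hi, hblank (i + 1) (by omega), M.update_blank]

/-- If a partial tiling with finite support contains the bottom left corner of a diagram whose
bottom row starts with the input, then the automaton halts on this input. -/
theorem RowAutomaton.halts_of_tiling (ht : ∀ x y, TileRule M (viewFrom t x y))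
    (hfin : {z : ℤ × ℤ | t z.1 z.2 ≠ none}.Finite)
    (hstart : ∃ τ ∈ t 0 0, τ.left = true ∧ τ.bottom = true) {n : ℕ} {g : ℕ → S}
    (hg : ∀ i, n < i → g i = M.blank)
    (hin : ∀ i ≤ n + 1, ∃ τ ∈ t (i : ℕ) 0, τ.bottom = true ∧ τ.sym = g i) :
    M.Halts (M.start, g) := by
  by_contra hn
  obtain ⟨r, h0, hr⟩ := RowAutomaton.exists_trace_of_not_halts hn
  have hbase : RowEncodes M t 0 (M.start, g) := by
    have hex : ∃ w : ℕ, t w 0 = none := by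
      by_contra! h
      exact Set.infinite_range_of_injective (f := fun w : ℕ => ((w : ℤ), (0 : ℤ)))
        (fun a b hab => by simpa using hab)
        (hfin.subset (Set.range_subset_iff.2 fun w => h w))
    classical
    let w := Nat.find hex
    have hw : t w 0 = none := Nat.find_spec hex
    have hlt : ∀ i < w, ∃ τ, t i 0 = some τ := fun i hi =>
      Option.ne_none_iff_exists'.1 (Nat.find_min hex hi)
    have hnw : n + 1 < w := by
      by_contra hle
      obtain ⟨τ, hτ, -⟩ := hin w (by omega)
      simp [hw] at hτ
    have hsym : ∀ i < w, ∀ τ, t i 0 = some τ → τ.left = decide (i = 0) ∧ τ.bottom = true ∧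
        τ.state = M.start ∧ τ.head = g 0 ∧ τ.sym = g i := by
      intro i
      induction i with
      | zero =>
        intro hi τ hτ
        obtain ⟨τ₁, hτ₁, hl, hb⟩ := hstart
        obtain ⟨τ₂, hτ₂, -, hs⟩ := hin 0 (by omega)
        obtain rfl : τ = τ₁ := Option.some.inj (hτ.symm.trans hτ₁)
        obtain rfl : τ = τ₂ := Option.some.inj (hτ.symm.trans hτ₂)
        have htau : τ ∈ viewFrom t 0 0 0 0 := by simpa [viewFrom] using hτ
        refine ⟨by simpa using hl, hb, (ht 0 0).state_eq τ htau hb, ?_, hs⟩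
        rw [← hs]
        exact (ht 0 0).head_eq τ htau hl
      | succ i ih =>
        intro hi τ hτ
        obtain ⟨τ', hτ'⟩ := hlt i (by omega)
        obtain ⟨-, h2, h3, h4, h5⟩ := ih (by omega) τ' hτ'
        obtain ⟨k1, k2, k3, k4, k5⟩ := (ht i 0).right τ' (by simpa [viewFrom] using hτ') τ
          (by simpa [viewFrom] using hτ)
        refine ⟨by simpa using k1, k2.trans h2, k3.trans h3, k4.trans h4, ?_⟩
        -- Symbols are prescribed up to column `n + 1`, which is already blank; from there blanks
        -- propagate.
        rcases Nat.lt_or_ge n i with hi' | hi'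
        · rw [hg _ (by omega)]
          exact k5 h2 (h5.trans (hg i hi'))
        · obtain ⟨τ₂, hτ₂, -, hs⟩ := hin (i + 1) (by omega)
          obtain rfl : τ = τ₂ := Option.some.inj (hτ.symm.trans hτ₂)
          exact hs
    refine ⟨w, by omega, fun i hi => ?_, by simpa using hw, fun i hi => hg i (by omega)⟩
    obtain ⟨τ, hτ⟩ := hlt i hi
    obtain ⟨h1, h2, h3, h4, h5⟩ := hsym i hi τ hτ
    rw [Nat.cast_zero, hτ]
    obtain ⟨⟩ := τ
    simp_all
  have hall : ∀ j, RowEncodes M t j (r j) := by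
    intro j
    induction j with
    | zero => rw [h0]; exact hbase
    | succ j ih => exact ih.succ ht (hr j)
  -- An infinite run would fill column `0` upwards, against finite support.
  refine Set.infinite_range_of_injective (f := fun j : ℕ => ((0 : ℤ), (j : ℤ)))
    (fun a b hab => by simpa using hab)
    (hfin.subset (Set.range_subset_iff.2 fun j => ?_))
  obtain ⟨w, hw, hrow, -⟩ := hall j
  have := hrow 0 hw
  simp only [Nat.cast_zero] at this
  simp [this]

/-- The symbols of the auxiliary layer: `none` marks a blank position; otherwise there are a
counter, a flag that marks the paths that lead to diagrams, and possibly a tile. -/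
abbrev Cell (p : ℕ) (Q S : Type) : Type := Option (Fin (p + 1) × Bool × Option (Tile Q S))

namespace Cell

variable {p : ℕ}

/-- The flag of a cell. -/
def marked (c : Cell p Q S) : Bool := c.elim false fun x => x.2.1

/-- The tile in a cell. -/
def tile (c : Cell p Q S) : Option (Tile Q S) := c.bind fun x => x.2.2

/-- The cell holds the bottom left corner of a diagram. -/
def IsCorner (c : Cell p Q S) : Prop := ∃ τ ∈ c.tile, τ.left = true ∧ τ.bottom = true

theorem ne_none_of_marked {c : Cell p Q S} (h : c.marked = true) : c ≠ none := by
  rintro rfl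
  simp [marked] at h

theorem ne_none_of_tile {c : Cell p Q S} (h : c.tile ≠ none) : c ≠ none := by
  rintro rfl
  simp [tile] at h

end Cell

/-- The local rule, at the origin, for the auxiliary layer `c` over a set `β` of breaks. -/
structure CellRule (M : RowAutomaton Q S) (p : ℕ) (β : ℤ → ℤ → Prop) (c : ℤ → ℤ → Cell p Q S) :
    Prop where
  not_break : c 0 0 = none → ¬ β 0 0
  aperiodic : c 0 0 ≠ none → (∃ a b : ℤ, a.natAbs + b.natAbs ≤ 2 * p ∧ β a b) ∨
    c p 0 ≠ c 0 0 ∨ c (-p) 0 ≠ c 0 0 ∨ c 0 p ≠ c 0 0 ∨ c 0 (-p) ≠ c 0 0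
  marked_of_corner : c 0 0 ≠ none → c (-1) 0 = none → c 0 (-1) = none → (c 0 0).marked = true
  marked_step : (c 0 0).marked = true →
    (c 0 0).IsCorner ∨ (c 1 0).marked = true ∨ (c 0 (-1)).marked = true
  tiles : TileRule M fun a b => (c a b).tile

/-- A nonblank cell that minimizes `f₁ + f₂` has blank neighbours on the left and below, so it is
marked. A marked cell that maximizes `f₁ - f₂` cannot continue right or down, so it is the corner of
a diagram. The maps `e`, `f₁`, `f₂` stand for coordinates in translates of a plane in `ℤ^d`. -/
theorem RowAutomaton.halts_of_finite {G : Type*} [AddCommGroup G] {e : ℤ → ℤ → G}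
    (he : ∀ a b a' b', e (a + a') (b + b') = e a b + e a' b') {f₁ f₂ : G → ℤ}
    (hf₁ : ∀ v a b, f₁ (v + e a b) = f₁ v + a) (hf₂ : ∀ v a b, f₂ (v + e a b) = f₂ v + b)
    {p : ℕ} {β : G → Prop} {c : G → Cell p Q S}
    (hc : ∀ v, CellRule M p (fun a b => β (v + e a b)) (fun a b => c (v + e a b)))
    (hfin : {v | c v ≠ none}.Finite) (hne : ∃ v, c v ≠ none) {n : ℕ} {g : ℕ → S}
    (hg : ∀ i, n < i → g i = M.blank)
    (hin : ∀ v, (c v).IsCorner → ∀ i ≤ n + 1,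
      ∃ τ ∈ (c (v + e (i : ℕ) 0)).tile, τ.bottom = true ∧ τ.sym = g i) :
    M.Halts (M.start, g) := by
  have he0 : e 0 0 = 0 := by simpa using he 0 0 0 0
  obtain ⟨v, hv, hmin⟩ := Set.exists_min_image _ (fun v => f₁ v + f₂ v) hfin hne
  have hmark : (c v).marked = true := by
    have h := (hc v).marked_of_corner
    simp only [he0, add_zero] at h
    refine h hv ?_ ?_ <;>
    · by_contra hne
      have := hmin _ hne
      simp only [hf₁, hf₂] at this
      omega
  obtain ⟨u, hu, hmax⟩ := Set.exists_max_image {v | (c v).marked = true} (fun v => f₁ v - f₂ v)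
    (hfin.subset fun v hv => Cell.ne_none_of_marked hv) ⟨v, hmark⟩
  have hcorner : (c u).IsCorner := by
    have h := (hc u).marked_step
    simp only [he0, add_zero] at h
    rcases h hu with h | h | h
    · exact h
    all_goals
      have := hmax _ h
      simp only [hf₁, hf₂] at this
      omega
  refine RowAutomaton.halts_of_tiling (t := fun a b => (c (u + e a b)).tile) (fun x y => ?_) ?_ ?_
    hg (fun i hi => hin u hcorner i hi)
  · have := (hc (u + e x y)).tiles
    change TileRule M fun a b => (c (u + e (x + a) (y + b))).tile
    simpa only [he, add_assoc] using this
  · refine Set.Finite.of_finite_image (f := fun z : ℤ × ℤ => u + e z.1 z.2)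
      (hfin.subset ?_) ?_
    · rintro _ ⟨z, hz, rfl⟩
      exact Cell.ne_none_of_tile hz
    · rintro ⟨a, b⟩ - ⟨a', b'⟩ - h
      have h1 := congrArg f₁ h
      have h2 := congrArg f₂ h
      simp only [hf₁, hf₂] at h1 h2
      ext <;> simp <;> omega
  · simpa [he0, Cell.IsCorner] using hcorner

end Soundness

/-! ### Construction of the auxiliary layer from the breaks -/

section Completeness

variable (R : ℕ) (B : ℤ → ℤ → Prop)

/-- The position `(x, y)` has a break within sup-distance `R`. -/
def FreeAt (x y : ℤ) : Prop :=
  ∃ a b : ℤ, -R ≤ a ∧ a ≤ R ∧ -R ≤ b ∧ b ≤ R ∧ B (x + a) (y + b)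

/-- The position `(x, y)` is a bottom left corner of the free region. -/
def SeedAt (x y : ℤ) : Prop :=
  FreeAt R B x y ∧ ¬ FreeAt R B (x - 1) y ∧ ¬ FreeAt R B x (y - 1)

/-- The position `(x, y)` is a seed without another seed to its lower right nearby. -/
def EndAt (x y : ℤ) : Prop :=
  SeedAt R B x y ∧ ∀ a b : ℤ, 1 ≤ a → a ≤ R → 1 ≤ b → b ≤ R → ¬ SeedAt R B (x + a) (y - b)

/-- The position `(x, y)` is on a path from a seed to a nearby seed to its lower right. -/
def PathAt (x y : ℤ) : Prop :=
  SeedAt R B x y ∨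
    (∃ a b i : ℤ, a ≤ R ∧ 1 ≤ b ∧ b ≤ R ∧ 0 ≤ i ∧ i ≤ a ∧
      SeedAt R B (x - i) y ∧ SeedAt R B (x - i + a) (y - b)) ∨
    ∃ b j : ℤ, b ≤ R ∧ 0 ≤ j ∧ j ≤ b ∧ SeedAt R B x (y + j - b)

/-- The `ℓ¹`-distance from `(x, y)` to the nearest break. -/
noncomputable def breakDist (x y : ℤ) : ℕ :=
  sInf {n | ∃ a b : ℤ, a.natAbs + b.natAbs = n ∧ B (x + a) (y + b)}

variable {R B}

/-- The break that makes a seed free sits exactly at offset `(R, R)`, since otherwise the left or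
lower neighbour would be free too. The square of radius `R` around this break is free. -/
theorem SeedAt.freeAt_box {x y : ℤ} (h : SeedAt R B x y) {i j : ℤ} (hi : 0 ≤ i) (hi' : i ≤ 2 * R)
    (hj : 0 ≤ j) (hj' : j ≤ 2 * R) : FreeAt R B (x + i) (y + j) := by
  obtain ⟨⟨a, b, h1, h2, h3, h4, hB⟩, hx, hy⟩ := h
  have ha : a = R := by
    by_contra hne
    exact hx ⟨a + 1, b, by omega, by omega, by omega, by omega, by
      rwa [show x - 1 + (a + 1) = x + a by ring]⟩
  have hb : b = R := by
    by_contra hne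
    exact hy ⟨a, b + 1, by omega, by omega, by omega, by omega, by
      rwa [show y - 1 + (b + 1) = y + b by ring]⟩
  exact ⟨a - i, b - j, by omega, by omega, by omega, by omega, by
    rwa [show x + i + (a - i) = x + a by ring, show y + j + (b - j) = y + b by ring]⟩

/-- A second seed in the free box of the first would have a free left or lower neighbour. -/
theorem SeedAt.eq_of_le {x y x' y' : ℤ} (h : SeedAt R B x y) (h' : SeedAt R B x' y')
    (hx : x ≤ x') (hx' : x' ≤ x + 2 * R) (hy : y ≤ y') (hy' : y' ≤ y + 2 * R) :
    x' = x ∧ y' = y := by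
  constructor
  · by_contra hne
    have := h.freeAt_box (i := x' - 1 - x) (j := y' - y) (by omega) (by omega) (by omega) (by omega)
    exact h'.2.1 (by simpa using this)
  · by_contra hne
    have := h.freeAt_box (i := x' - x) (j := y' - 1 - y) (by omega) (by omega) (by omega) (by omega)
    exact h'.2.2 (by simpa using this)

/-- Separation of diagrams: two nearby seeds in lower-left to upper-right position coincide by
`SeedAt.eq_of_le`, and the other diagonal position is excluded by the definition of an end. -/
theorem EndAt.eq_of_near {x y x' y' : ℤ} (h : EndAt R B x y) (h' : EndAt R B x' y')
    (hx : x' ≤ x + R) (hx' : x ≤ x' + R) (hy : y' ≤ y + R) (hy' : y ≤ y' + R) :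
    x' = x ∧ y' = y := by
  rcases le_or_gt x x' with h1 | h1 <;> rcases le_or_gt y y' with h2 | h2
  · exact h.1.eq_of_le h'.1 h1 (by omega) h2 (by omega)
  · rcases h1.eq_or_lt with rfl | h1
    · have := h'.1.eq_of_le h.1 le_rfl (by omega) h2.le (by omega)
      exact ⟨rfl, this.2.symm⟩
    · refine absurd h'.1 ?_
      have := h.2 (x' - x) (y - y') (by omega) (by omega) (by omega) (by omega)
      simpa using this
  · rcases h2.eq_or_lt with rfl | h2
    · have := h'.1.eq_of_le h.1 h1.le (by omega) le_rfl (by omega)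
      exact ⟨this.1.symm, rfl⟩
    · refine absurd h.1 ?_
      have := h'.2 (x - x') (y' - y) (by omega) (by omega) (by omega) (by omega)
      simpa using this
  · have := h'.1.eq_of_le h.1 h1.le (by omega) h2.le (by omega)
    exact ⟨this.1.symm, this.2.symm⟩

theorem PathAt.freeAt {x y : ℤ} (h : PathAt R B x y) : FreeAt R B x y := by
  rcases h with h | ⟨a, b, i, h1, h2, h3, h4, h5, h, -⟩ | ⟨b, j, h1, h2, h3, h⟩
  · exact h.1
  · simpa using h.freeAt_box (i := i) (j := 0) h4 (by omega) le_rfl (by omega)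
  · simpa using h.freeAt_box (i := 0) (j := b - j) le_rfl (by omega) (by omega) (by omega)

/-- From a seed that is not an end, the path runs right to the column of a nearby lower right seed,
then down to it. -/
theorem PathAt.step {x y : ℤ} (h : PathAt R B x y) :
    EndAt R B x y ∨ PathAt R B (x + 1) y ∨ PathAt R B x (y - 1) := by
  have seed : SeedAt R B x y →
      EndAt R B x y ∨ PathAt R B (x + 1) y ∨ PathAt R B x (y - 1) := by
    intro h
    by_cases hend : EndAt R B x y
    · exact .inl hend
    · have : ∃ a b : ℤ, 1 ≤ a ∧ a ≤ R ∧ 1 ≤ b ∧ b ≤ R ∧ SeedAt R B (x + a) (y - b) := by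
        by_contra! hn
        exact hend ⟨h, hn⟩
      obtain ⟨a, b, h1, h2, h3, h4, h5⟩ := this
      exact .inr (.inl (.inr (.inl ⟨a, b, 1, h2, h3, h4, by omega, h1, by simpa using h,
        by simpa using h5⟩)))
  rcases h with h | ⟨a, b, i, h1, h2, h3, h4, h5, h6, h7⟩ | ⟨b, j, h1, h2, h3, h⟩
  · exact seed h
  · rcases h5.eq_or_lt with rfl | h5
    · refine .inr (.inr (.inr (.inr ⟨b, 1, h3, by omega, h2, ?_⟩)))
      simpa using h7
    · refine .inr (.inl (.inr (.inl ⟨a, b, i + 1, h1, h2, h3, by omega, h5, ?_⟩)))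
      rw [show x + 1 - (i + 1) = x - i by ring]
      exact ⟨h6, h7⟩
  · rcases h3.eq_or_lt with rfl | h3
    · exact seed (by simpa using h)
    · refine .inr (.inr (.inr (.inr ⟨b, j + 1, h1, by omega, h3, ?_⟩)))
      rwa [show y - 1 + (j + 1) - b = y + j - b by ring]

theorem breakDist_le {x y a b : ℤ} (h : B (x + a) (y + b)) :
    breakDist B x y ≤ a.natAbs + b.natAbs :=
  Nat.sInf_le ⟨a, b, rfl, h⟩

theorem exists_break {x y : ℤ} (h : FreeAt R B x y) :
    ∃ a b : ℤ, a.natAbs + b.natAbs = breakDist B x y ∧ B (x + a) (y + b) := by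
  obtain ⟨a, b, -, -, -, -, h⟩ := h
  exact Nat.sInf_mem (s := {n | ∃ a b : ℤ, a.natAbs + b.natAbs = n ∧ B (x + a) (y + b)})
    ⟨_, a, b, rfl, h⟩

theorem breakDist_le_add {x y : ℤ} {a b : ℤ} (h : FreeAt R B (x + a) (y + b)) :
    breakDist B x y ≤ breakDist B (x + a) (y + b) + a.natAbs + b.natAbs := by
  obtain ⟨a', b', h1, h2⟩ := exists_break h
  have := breakDist_le (B := B) (x := x) (y := y) (a := a + a') (b := b + b') (by
    rwa [← add_assoc, ← add_assoc])
  omega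

/-- Far from all breaks, some neighbour at distance `p` in a coordinate direction is nearer to the
set of breaks by exactly `p`, unless it is not free. -/
theorem exists_breakDist_sub {p : ℕ} {x y : ℤ} (h : FreeAt R B x y)
    (hd : 2 * p < breakDist B x y) :
    ∃ a b : ℤ, ((a = p ∧ b = 0) ∨ (a = -p ∧ b = 0) ∨ (a = 0 ∧ b = p) ∨ (a = 0 ∧ b = -p)) ∧
      (FreeAt R B (x + a) (y + b) →
        breakDist B (x + a) (y + b) + p = breakDist B x y) := by
  obtain ⟨a, b, h1, h2⟩ := exists_break h
  have key : ∀ a' b' : ℤ, a'.natAbs + b'.natAbs = p →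
      (a - a').natAbs + (b - b').natAbs + p = a.natAbs + b.natAbs →
      FreeAt R B (x + a') (y + b') → breakDist B (x + a') (y + b') + p = breakDist B x y := by
    intro a' b' hp hab hf
    have h3 := breakDist_le (B := B) (x := x + a') (y := y + b') (a := a - a') (b := b - b') (by
      rwa [show x + a' + (a - a') = x + a by ring, show y + b' + (b - b') = y + b by ring])
    have h4 := breakDist_le_add hf
    omega
  -- As `|a| + |b| > 2p`, some coordinate has absolute value at least `p`; moving by `p` along it
  -- brings this break nearer by exactly `p`.
  have hcase : (p : ℤ) ≤ a ∨ a ≤ -p ∨ (p : ℤ) ≤ b ∨ b ≤ -p := by omega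
  rcases hcase with h | h | h | h
  · exact ⟨p, 0, by simp, key p 0 (by omega) (by omega)⟩
  · exact ⟨-p, 0, by simp, key (-p) 0 (by omega) (by omega)⟩
  · exact ⟨0, p, by simp, key 0 p (by omega) (by omega)⟩
  · exact ⟨0, -p, by simp, key 0 (-p) (by omega) (by omega)⟩

variable (R B) {Q S : Type} (M : RowAutomaton Q S) (t w : ℕ) (r : ℕ → Q × (ℕ → S)) (p : ℕ)

/-- The tile at position `(i, j)` of the diagram of a run. -/
def diagramTile (i j : ℕ) : Tile Q S :=
  ⟨decide (i = 0), decide (j = 0), (r j).1, (r j).2 0, (r j).2 i⟩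

open scoped Classical in
/-- The tile of the diagram at some position that satisfies `P`, if there is one. -/
noncomputable def someTile (P : ℕ × ℕ → Prop) : Option (Tile Q S) :=
  if h : ∃ z, P z then some (diagramTile r h.choose.1 h.choose.2) else none

/-- The tile layer that places a diagram with `w` columns and `t + 1` rows at every end. -/
noncomputable def tileLayer (x y : ℤ) : Option (Tile Q S) :=
  someTile r fun z => z.1 < w ∧ z.2 ≤ t ∧ EndAt R B (x - z.1) (y - z.2)

open scoped Classical in
/-- The auxiliary layer over a set of breaks. -/
noncomputable def cellLayer (x y : ℤ) : Cell p Q S :=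
  if FreeAt R B x y then
    some (Fin.ofNat (p + 1) (breakDist B x y), decide (PathAt R B x y), tileLayer R B t w r x y)
  else none

variable {R B M t w r p}

/-- The range includes a margin of one cell, where the tile rule still looks. Any end with a tile
there is within `R` of the given one, hence equal to it. -/
theorem tileLayer_of_endAt (hw : w + 1 ≤ R) (ht : t + 2 ≤ R) {x y : ℤ} (h : EndAt R B x y)
    {i j : ℤ} (hi : -1 ≤ i) (hi' : i ≤ w) (hj : -1 ≤ j) (hj' : j ≤ t + 1) :
    tileLayer R B t w r (x + i) (y + j) =
      if 0 ≤ i ∧ i < w ∧ 0 ≤ j ∧ j ≤ t then some (diagramTile r i.toNat j.toNat) else none := by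
  have huniq : ∀ z : ℕ × ℕ, z.1 < w → z.2 ≤ t → EndAt R B (x + i - z.1) (y + j - z.2) →
      (z.1 : ℤ) = i ∧ (z.2 : ℤ) = j := by
    intro z h1 h2 h3
    have := h.eq_of_near h3 (by omega) (by omega) (by omega) (by omega)
    omega
  rw [tileLayer, someTile]
  split_ifs with h1 h2 h2
  · obtain ⟨h3, h4, h5⟩ := h1.choose_spec
    obtain ⟨h6, h7⟩ := huniq _ h3 h4 h5
    congr 2 <;> omega
  · obtain ⟨h3, h4, h5⟩ := h1.choose_spec
    obtain ⟨h6, h7⟩ := huniq _ h3 h4 h5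
    omega
  · refine absurd ⟨(i.toNat, j.toNat), ?_, ?_, ?_⟩ h1
    · simp only; omega
    · simp only; omega
    · rw [show x + i - ((i.toNat, j.toNat) : ℕ × ℕ).1 = x by simp only; omega,
        show y + j - ((i.toNat, j.toNat) : ℕ × ℕ).2 = y by simp only; omega]
      exact h
  · rfl

theorem exists_endAt_of_tileLayer {x y : ℤ} {τ : Tile Q S} (h : tileLayer R B t w r x y = some τ) :
    ∃ i j : ℕ, i < w ∧ j ≤ t ∧ EndAt R B (x - i) (y - j) ∧ τ = diagramTile r i j := by
  rw [tileLayer, someTile] at h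
  split_ifs at h with h1
  obtain ⟨h3, h4, h5⟩ := h1.choose_spec
  exact ⟨_, _, h3, h4, h5, by simpa using h.symm⟩

theorem freeAt_of_tileLayer (hw : w + 1 ≤ R) (ht : t + 2 ≤ R) {x y : ℤ}
    (h : tileLayer R B t w r x y ≠ none) : FreeAt R B x y := by
  obtain ⟨τ, hτ⟩ := Option.ne_none_iff_exists'.1 h
  obtain ⟨i, j, hi, hj, hend, -⟩ := exists_endAt_of_tileLayer hτ
  simpa using hend.1.freeAt_box (i := i) (j := j) (by omega) (by omega) (by omega) (by omega)

theorem tile_cellLayer (hw : w + 1 ≤ R) (ht : t + 2 ≤ R) (x y : ℤ) :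
    (cellLayer R B t w r p x y).tile = tileLayer R B t w r x y := by
  rw [cellLayer]
  split_ifs with h
  · rfl
  · by_contra hne
    exact h (freeAt_of_tileLayer hw ht fun h0 => hne (h0 ▸ rfl))

theorem marked_cellLayer (x y : ℤ) :
    (cellLayer R B t w r p x y).marked = true ↔ PathAt R B x y := by
  rw [cellLayer]
  split_ifs with h
  · simp [Cell.marked]
  · simpa [Cell.marked] using fun h' : PathAt R B x y => h h'.freeAt

theorem cellLayer_eq_none_iff (x y : ℤ) :
    cellLayer R B t w r p x y = none ↔ ¬ FreeAt R B x y := by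
  rw [cellLayer]
  split_ifs with h <;> simp [h]

/-- By `hb` the last column `w - 1` is always blank, as `blank_of_last` demands. In row `t` the rule
`above` is vacuous because the automaton has halted. -/
theorem tileRule_tileLayer (hw : w + 1 ≤ R) (ht : t + 2 ≤ R) (h0 : (r 0).1 = M.start)
    (hs : ∀ j < t, M.step (r j) = some (r (j + 1))) (hh : M.next (r t).1 ((r t).2 0) = none)
    (hb : ∀ j ≤ t, ∀ i, w ≤ i + 1 → (r j).2 i = M.blank)
    (hin : ∀ i, (r 0).2 i = M.blank → (r 0).2 (i + 1) = M.blank) :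
    TileRule M (tileLayer R B t w r) := by
  have key : ∀ τ ∈ tileLayer R B t w r 0 0, ∃ i j : ℕ, i < w ∧ j ≤ t ∧ τ = diagramTile r i j ∧
      ∀ a b : ℤ, -1 ≤ a → a ≤ 1 → -1 ≤ b → b ≤ 1 → tileLayer R B t w r a b =
        if 0 ≤ i + a ∧ i + a < w ∧ 0 ≤ j + b ∧ j + b ≤ t then
          some (diagramTile r (i + a).toNat (j + b).toNat) else none := by
    intro τ hτ
    obtain ⟨i, j, hi, hj, hend, rfl⟩ := exists_endAt_of_tileLayer hτ
    refine ⟨i, j, hi, hj, rfl, fun a b h1 h2 h3 h4 => ?_⟩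
    have := tileLayer_of_endAt (r := r) hw ht hend (i := i + a) (j := j + b)
      (by omega) (by omega) (by omega) (by omega)
    rwa [show (0 - i + (i + a) : ℤ) = a by ring, show (0 - j + (j + b) : ℤ) = b by ring] at this
  refine ⟨?_, ?_, ?_, ?_, ?_, ?_⟩
  · intro τ hτ hl
    obtain ⟨i, j, hi, hj, rfl, h⟩ := key τ hτ
    obtain rfl : i = 0 := by simpa [diagramTile] using hl
    rfl
  · intro τ hτ hl
    obtain ⟨i, j, hi, hj, rfl, h⟩ := key τ hτ
    obtain rfl : j = 0 := by simpa [diagramTile] using hl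
    exact h0
  · intro τ hτ τ' hτ'
    obtain ⟨i, j, hi, hj, rfl, h⟩ := key τ hτ
    rw [Option.mem_def, h 1 0 (by omega) (by omega) (by omega) (by omega)] at hτ'
    split_ifs at hτ' with hc
    obtain rfl := Option.some.inj hτ'
    have hx : ((i : ℤ) + 1).toNat = i + 1 := by omega
    simp only [hx, add_zero, Int.toNat_natCast, diagramTile]
    refine ⟨by simp, trivial, trivial, trivial, fun hj0 hsym => ?_⟩
    obtain rfl : j = 0 := by simpa using hj0
    exact hin i hsym
  · intro τ hτ hn
    obtain ⟨i, j, hi, hj, rfl, h⟩ := key τ hτ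
    rw [h 1 0 (by omega) (by omega) (by omega) (by omega)] at hn
    split_ifs at hn with hc
    exact hb j hj i (by omega)
  · intro τ hτ q hq
    obtain ⟨i, j, hi, hj, rfl, h⟩ := key τ hτ
    have hjt : j < t := by
      refine lt_of_le_of_ne hj ?_
      rintro rfl
      simp [diagramTile, hh] at hq
    have hstep := hs j hjt
    simp only [RowAutomaton.step, Option.map_eq_some_iff] at hstep
    obtain ⟨q', hq', hr⟩ := hstep
    obtain rfl : q' = q := Option.some.inj (hq'.symm.trans hq)
    rw [h 0 1 (by omega) (by omega) (by omega) (by omega),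
      if_pos (by omega), h (-1) 0 (by omega) (by omega) (by omega) (by omega),
      h 1 0 (by omega) (by omega) (by omega) (by omega)]
    refine ⟨_, rfl, ?_⟩
    have hx : ((j : ℤ) + 1).toNat = j + 1 := by omega
    simp only [hx, add_zero, Int.toNat_natCast, diagramTile, ← hr]
    refine ⟨trivial, by simp, trivial, ?_⟩
    rw [RowAutomaton.nextRow]
    congr 1
    · rcases i with _ | i
      · simp [RowAutomaton.leftOf]
      · rw [if_pos (by omega)]
        have hx : ((i + 1 : ℕ) + -1 : ℤ).toNat = i := by omega
        rw [hx]
        rfl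
    · split_ifs with hc
      · have hx : ((i : ℤ) + 1).toNat = i + 1 := by omega
        simp [hx]
      · exact hb j hj (i + 1) (by omega)
  · intro τ hτ hl
    obtain ⟨i, j, hi, hj, rfl, h⟩ := key τ hτ
    have hj0 : j ≠ 0 := by simpa [diagramTile] using hl
    rw [h 0 (-1) (by omega) (by omega) (by omega) (by omega), if_pos (by omega)]
    simp

theorem cellRule_cellLayer (hp : 0 < p) (hw0 : 0 < w) (hw : w + 1 ≤ R) (ht : t + 2 ≤ R)
    (hT : TileRule M (tileLayer R B t w r)) : CellRule M p B (cellLayer R B t w r p) where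
  not_break h hB := by
    rw [cellLayer_eq_none_iff] at h
    exact h ⟨0, 0, by omega, by omega, by omega, by omega, by simpa using hB⟩
  aperiodic h := by
    rw [ne_eq, cellLayer_eq_none_iff, not_not] at h
    rcases Nat.lt_or_ge (2 * p) (breakDist B 0 0) with hd | hd
    · right
      obtain ⟨a, b, hab, hdist⟩ := exists_breakDist_sub h hd
      have hne : cellLayer R B t w r p a b ≠ cellLayer R B t w r p 0 0 := by
        intro heq
        have hf : FreeAt R B a b := by
          by_contra hn
          rw [(cellLayer_eq_none_iff _ _).2 hn, eq_comm, cellLayer_eq_none_iff] at heq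
          exact heq h
        have hdist := hdist (by simpa using hf)
        rw [cellLayer, cellLayer, if_pos h, if_pos hf] at heq
        have h1 := congrArg Fin.val (congrArg Prod.fst (Option.some.inj heq))
        simp only [Fin.val_ofNat, zero_add] at h1 hdist
        rw [← hdist] at h1
        -- Equal counters would give `p ≡ 0` modulo `p + 1`, against `0 < p`.
        have h2 : breakDist B a b + 0 ≡ breakDist B a b + p [MOD p + 1] := h1
        have h3 := Nat.ModEq.add_left_cancel' _ h2
        rw [Nat.ModEq, Nat.zero_mod, Nat.mod_eq_of_lt (Nat.lt_succ_self p)] at h3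
        omega
      rcases hab with ⟨rfl, rfl⟩ | ⟨rfl, rfl⟩ | ⟨rfl, rfl⟩ | ⟨rfl, rfl⟩
      · exact .inl hne
      · exact .inr (.inl hne)
      · exact .inr (.inr (.inl hne))
      · exact .inr (.inr (.inr hne))
    · obtain ⟨a, b, h1, h2⟩ := exists_break h
      exact .inl ⟨a, b, by omega, by simpa using h2⟩
  marked_of_corner h h1 h2 := by
    rw [ne_eq, cellLayer_eq_none_iff, not_not] at h
    rw [cellLayer_eq_none_iff] at h1 h2
    rw [marked_cellLayer]
    exact .inl ⟨h, by simpa using h1, by simpa using h2⟩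
  marked_step h := by
    rw [marked_cellLayer] at h
    rw [marked_cellLayer, marked_cellLayer]
    refine h.step.imp_left fun hend => ?_
    rw [Cell.IsCorner, tile_cellLayer hw ht]
    have := tileLayer_of_endAt (r := r) hw ht hend (i := 0) (j := 0)
      (by omega) (by omega) (by omega) (by omega)
    rw [if_pos (by omega)] at this
    exact ⟨_, this, rfl, rfl⟩
  tiles := by simpa only [tile_cellLayer hw ht] using hT

theorem input_of_isCorner (hw : w + 1 ≤ R) (ht : t + 2 ≤ R)
    (h : (cellLayer R B t w r p 0 0).IsCorner) (i : ℕ) (hi : i < w) :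
    ∃ τ ∈ (cellLayer R B t w r p i 0).tile, τ.bottom = true ∧ τ.sym = (r 0).2 i := by
  obtain ⟨τ, hτ, h1, h2⟩ := h
  rw [tile_cellLayer hw ht] at hτ
  obtain ⟨i', j', hi', hj', hend, rfl⟩ := exists_endAt_of_tileLayer hτ
  obtain rfl : i' = 0 := by simpa [diagramTile] using h1
  obtain rfl : j' = 0 := by simpa [diagramTile] using h2
  have := tileLayer_of_endAt (r := r) hw ht hend (i := i) (j := 0)
      (by omega) (by omega) (by omega) (by omega)
  rw [if_pos (by omega)] at this
  rw [tile_cellLayer hw ht]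
  exact ⟨diagramTile r i 0, by simpa using this, rfl, rfl⟩

/-! ### Locality and shift equivariance of the auxiliary layer -/

section Locality

variable {B' : ℤ → ℤ → Prop}

theorem cellLayer_eq {x y x' y' : ℤ} (hf : FreeAt R B x y ↔ FreeAt R B' x' y')
    (hm : PathAt R B x y ↔ PathAt R B' x' y')
    (hd : FreeAt R B x y → breakDist B x y = breakDist B' x' y')
    (ht : tileLayer R B t w r x y = tileLayer R B' t w r x' y') :
    cellLayer R B t w r p x y = cellLayer R B' t w r p x' y' := by
  by_cases h : FreeAt R B x y
  · rw [cellLayer, cellLayer, if_pos h, if_pos (hf.1 h), hd h, ht, decide_eq_decide.2 hm]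
  · rw [(cellLayer_eq_none_iff _ _).2 h, (cellLayer_eq_none_iff _ _).2 (hf.not.1 h)]

theorem freeAt_viewFrom (u v x y : ℤ) :
    FreeAt R (viewFrom B u v) x y ↔ FreeAt R B (u + x) (v + y) := by
  simp only [FreeAt, viewFrom, add_assoc]

theorem seedAt_viewFrom (u v x y : ℤ) :
    SeedAt R (viewFrom B u v) x y ↔ SeedAt R B (u + x) (v + y) := by
  simp only [SeedAt, freeAt_viewFrom, add_sub_assoc]

theorem endAt_viewFrom (u v x y : ℤ) :
    EndAt R (viewFrom B u v) x y ↔ EndAt R B (u + x) (v + y) := by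
  simp only [EndAt, seedAt_viewFrom, add_sub_assoc, add_assoc]

theorem pathAt_viewFrom (u v x y : ℤ) :
    PathAt R (viewFrom B u v) x y ↔ PathAt R B (u + x) (v + y) := by
  simp only [PathAt, seedAt_viewFrom, add_sub_assoc, add_assoc]

theorem breakDist_viewFrom (u v x y : ℤ) :
    breakDist (viewFrom B u v) x y = breakDist B (u + x) (v + y) := by
  simp only [breakDist, viewFrom, add_assoc]

theorem cellLayer_viewFrom (u v x y : ℤ) :
    cellLayer R (viewFrom B u v) t w r p x y = cellLayer R B t w r p (u + x) (v + y) := by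
  refine cellLayer_eq (freeAt_viewFrom u v x y) (pathAt_viewFrom u v x y)
    (fun _ => breakDist_viewFrom u v x y) ?_
  simp only [tileLayer, endAt_viewFrom, add_sub_assoc]

/-- The radii add up: the seeds consulted are at most `2R` away, a seed looks one step further, and
freeness looks `R` further, which gives `3R + 1`. -/
theorem freeAt_congr
    (h : ∀ a b : ℤ, a.natAbs ≤ 3 * R + 1 → b.natAbs ≤ 3 * R + 1 → (B a b ↔ B' a b))
    {x y : ℤ} (hx : x.natAbs ≤ 2 * R + 1) (hy : y.natAbs ≤ 2 * R + 1) :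
    FreeAt R B x y ↔ FreeAt R B' x y := by
  constructor <;> rintro ⟨a, b, h1, h2, h3, h4, h5⟩ <;>
    refine ⟨a, b, h1, h2, h3, h4, ?_⟩
  · exact (h _ _ (by omega) (by omega)).1 h5
  · exact (h _ _ (by omega) (by omega)).2 h5

theorem seedAt_congr
    (h : ∀ a b : ℤ, a.natAbs ≤ 3 * R + 1 → b.natAbs ≤ 3 * R + 1 → (B a b ↔ B' a b))
    {x y : ℤ} (hx : x.natAbs ≤ 2 * R) (hy : y.natAbs ≤ 2 * R) :
    SeedAt R B x y ↔ SeedAt R B' x y := by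
  simp only [SeedAt]
  rw [freeAt_congr h (by omega) (by omega), freeAt_congr h (x := x - 1) (by omega) (by omega),
    freeAt_congr h (x := x) (y := y - 1) (by omega) (by omega)]

theorem endAt_congr
    (h : ∀ a b : ℤ, a.natAbs ≤ 3 * R + 1 → b.natAbs ≤ 3 * R + 1 → (B a b ↔ B' a b))
    {x y : ℤ} (hx : x.natAbs ≤ R) (hy : y.natAbs ≤ R) :
    EndAt R B x y ↔ EndAt R B' x y := by
  refine and_congr (seedAt_congr h (by omega) (by omega)) ?_
  refine forall₂_congr fun a b => forall₄_congr fun h1 h2 h3 h4 => not_congr ?_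
  exact seedAt_congr h (by omega) (by omega)

theorem pathAt_congr
    (h : ∀ a b : ℤ, a.natAbs ≤ 3 * R + 1 → b.natAbs ≤ 3 * R + 1 → (B a b ↔ B' a b)) :
    PathAt R B 0 0 ↔ PathAt R B' 0 0 := by
  refine or_congr (seedAt_congr h (by omega) (by omega)) (or_congr ?_ ?_)
  · refine exists₃_congr fun a b i => and_congr_right fun h1 => and_congr_right fun h2 =>
      and_congr_right fun h3 => and_congr_right fun h4 => and_congr_right fun h5 => ?_
    exact and_congr (seedAt_congr h (by omega) (by omega)) (seedAt_congr h (by omega) (by omega))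
  · refine exists₂_congr fun b j => and_congr_right fun h1 => and_congr_right fun h2 =>
      and_congr_right fun h3 => ?_
    exact seedAt_congr h (by omega) (by omega)

/-- The distance is not local in general, but at a free position the nearest break is at
`ℓ¹`-distance at most `2R`, inside the window. -/
theorem breakDist_congr_le
    (h : ∀ a b : ℤ, a.natAbs ≤ 3 * R + 1 → b.natAbs ≤ 3 * R + 1 → (B a b ↔ B' a b))
    (hf : FreeAt R B 0 0) : breakDist B' 0 0 ≤ breakDist B 0 0 := by
  obtain ⟨a, b, h1, h2⟩ := exists_break hf
  obtain ⟨a', b', h3, h4, h5, h6, h7⟩ := hf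
  have h8 := breakDist_le h7
  rw [← h1]
  by_cases hab : a.natAbs ≤ 3 * R + 1 ∧ b.natAbs ≤ 3 * R + 1
  · exact breakDist_le ((h _ _ (by omega) (by omega)).1 h2)
  · omega

/-- The auxiliary layer depends on the nearby breaks only. -/
theorem cellLayer_congr (hw : w + 1 ≤ R) (ht : t + 2 ≤ R)
    (h : ∀ a b : ℤ, a.natAbs ≤ 3 * R + 1 → b.natAbs ≤ 3 * R + 1 → (B a b ↔ B' a b)) :
    cellLayer R B t w r p 0 0 = cellLayer R B' t w r p 0 0 := by
  have hfree := freeAt_congr h (x := 0) (y := 0) (by simp) (by simp)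
  refine cellLayer_eq hfree (pathAt_congr h) (fun hf => ?_) ?_
  · exact le_antisymm (breakDist_congr_le (fun a b ha hb => (h a b ha hb).symm) (hfree.1 hf))
      (breakDist_congr_le h hf)
  · refine congrArg (someTile r) (funext fun z => propext ?_)
    refine and_congr_right fun h1 => and_congr_right fun h2 => ?_
    exact endAt_congr h (by omega) (by omega)

end Locality

end Completeness

/-! ### Computable presentations -/

section Presentation

/-- A property of configurations that depends on finitely many positions can be imposed everywhere
by a finite list of forbidden patterns. -/
theorem exists_forbidden_list {d k : ℕ} (D : Finset (Fin d → ℤ))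
    (P : ((Fin d → ℤ) → Fin k) → Prop)
    (hP : ∀ x x' : (Fin d → ℤ) → Fin k, (∀ v ∈ D, x v = x' v) → P x → P x') :
    ∃ L : List (List ((Fin d → ℤ) × ℕ)), ∀ x : (Fin d → ℤ) → Fin k,
      (∀ p ∈ L, ∀ u, ¬ PatternOccursAt p x u) ↔ ∀ u, P (shift u x) := by
  classical
  -- Forbid each pattern on `D` that extends to no configuration with property `P`.
  refine ⟨(Finset.univ.filter fun f : D → Fin k =>
      ¬ ∃ x : (Fin d → ℤ) → Fin k, (∀ v : D, x v = f v) ∧ P x).toList.map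
    fun f => D.attach.toList.map fun v => (v.1, (f v).val), fun x => ⟨fun h u => ?_, ?_⟩⟩
  · by_contra hu
    refine h (D.attach.toList.map fun v => (v.1, (shift u x v.1).val))
      (List.mem_map.2 ⟨fun v => shift u x v.1, ?_, rfl⟩) u ?_
    · simp only [Finset.mem_toList, Finset.mem_filter, Finset.mem_univ, true_and]
      rintro ⟨x', hx', hPx'⟩
      exact hu (hP x' _ (fun v hv => hx' ⟨v, hv⟩) hPx')
    · intro c hc
      obtain ⟨v, -, rfl⟩ := List.mem_map.1 hc
      rfl
  · intro h p hp u hu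
    obtain ⟨f, hf, rfl⟩ := List.mem_map.1 hp
    simp only [Finset.mem_toList, Finset.mem_filter, Finset.mem_univ, true_and] at hf
    refine hf ⟨shift u x, fun v => Fin.ext ?_, h u⟩
    exact hu (v.1, (f v).val) (List.mem_map.2 ⟨v, by simp, rfl⟩)

/-- The patterns that forbid pairs of symbols, given by the digits of the input `n`, at distance
`i ≤ n + 1` along a coordinate axis. -/
def inputPatterns {d : ℕ} (i₀ : Fin d) (bad : Fin 4 → List (ℕ × ℕ)) (n : ℕ) :
    List (List ((Fin d → ℤ) × ℕ)) :=
  (List.range (n + 2)).flatMap fun i => (bad (inputDigit n i)).map fun s =>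
    [(0, s.1), (Pi.single i₀ (i : ℤ), s.2)]

theorem primrec_natCast_int : Primrec fun n : ℕ => (n : ℤ) := by
  refine Primrec.encode_iff.1 ?_
  refine (Primrec.nat_mul.comp (Primrec.const 2) Primrec.id).of_eq fun n => ?_
  rfl

theorem primrec_inputPatterns {d : ℕ} (i₀ : Fin d) (bad : Fin 4 → List (ℕ × ℕ)) :
    Primrec (inputPatterns i₀ bad) := by
  have hpos : Primrec fun i : ℕ => (Pi.single i₀ (i : ℤ) : Fin d → ℤ) := by
    refine Primrec.fin_curry.2 ?_
    refine (Primrec.ite (Primrec.eq.comp Primrec.snd (Primrec.const i₀))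
      (primrec_natCast_int.comp Primrec.fst) (Primrec.const 0)).of_eq fun z => ?_
    simp [Pi.single_apply]
  refine Primrec.list_flatMap (Primrec.list_range.comp
    (Primrec.nat_add.comp Primrec.id (Primrec.const 2))) ?_
  -- `bad` has a finite domain, so it is primitive recursive however it is defined.
  refine Primrec.list_map ((Primrec.dom_finite bad).comp primrec_inputDigit) ?_
  refine Primrec.list_cons.comp ((Primrec.const 0).pair (Primrec.fst.comp Primrec.snd)) ?_
  refine Primrec.list_cons.comp (Primrec.pair ?_ (Primrec.snd.comp Primrec.snd))
    (Primrec.const [])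
  exact hpos.comp (Primrec.snd.comp Primrec.fst)

end Presentation

/-! ### Breaks in coordinate planes and the resulting SFTs -/

section Plane

variable {d : ℕ} (i₀ i₁ : Fin d)

/-- The vector with coordinates `a` and `b` in the plane spanned by two coordinate axes. -/
def planeVec (a b : ℤ) : Fin d → ℤ := Pi.single i₀ a + Pi.single i₁ b

theorem planeVec_add (a b a' b' : ℤ) :
    planeVec i₀ i₁ (a + a') (b + b') = planeVec i₀ i₁ a b + planeVec i₀ i₁ a' b' := by
  simp only [planeVec, Pi.single_add]
  abel

theorem planeVec_zero_zero : planeVec i₀ i₁ 0 0 = 0 := by simp [planeVec]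

/-- The configuration `x` is not `p`-periodic at `v`. -/
def IsBreak {A : Type*} (p : ℕ) (x : (Fin d → ℤ) → A) (v : Fin d → ℤ) : Prop :=
  ∃ i, x (v + Pi.single i (p : ℤ)) ≠ x v

theorem isBreak_shift {A : Type*} (p : ℕ) (x : (Fin d → ℤ) → A) (u v : Fin d → ℤ) :
    IsBreak p (shift u x) v ↔ IsBreak p x (u + v) := by
  simp only [IsBreak, shift_apply, add_assoc]

/-- A finite set of positions that determine the breaks in a square of radius `N`. -/
noncomputable def breakWindow (p N : ℕ) : Finset (Fin d → ℤ) :=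
  (Finset.Icc (-N : ℤ) N ×ˢ Finset.Icc (-N : ℤ) N ×ˢ (Finset.univ : Finset (Option (Fin d)))).image
    fun z => planeVec i₀ i₁ z.1 z.2.1 + z.2.2.elim 0 fun i => Pi.single i (p : ℤ)

variable {i₀ i₁}

theorem planeVec_mem_breakWindow (p : ℕ) {N : ℕ} {a b : ℤ} (ha : a.natAbs ≤ N)
    (hb : b.natAbs ≤ N) : planeVec i₀ i₁ a b ∈ breakWindow i₀ i₁ p N :=
  Finset.mem_image.2 ⟨(a, b, none), by simp; omega, by simp⟩

theorem planeVec_add_mem_breakWindow (p : ℕ) {N : ℕ} {a b : ℤ} (ha : a.natAbs ≤ N)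
    (hb : b.natAbs ≤ N) (i : Fin d) :
    planeVec i₀ i₁ a b + Pi.single i (p : ℤ) ∈ breakWindow i₀ i₁ p N :=
  Finset.mem_image.2 ⟨(a, b, some i), by simp; omega, by simp⟩

theorem isBreak_congr {A : Type*} {p N : ℕ} {x x' : (Fin d → ℤ) → A}
    (h : ∀ v ∈ breakWindow i₀ i₁ p N, x v = x' v) {a b : ℤ} (ha : a.natAbs ≤ N)
    (hb : b.natAbs ≤ N) :
    IsBreak p x (planeVec i₀ i₁ a b) ↔ IsBreak p x' (planeVec i₀ i₁ a b) := by
  refine exists_congr fun i => ?_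
  rw [h _ (planeVec_mem_breakWindow p ha hb), h _ (planeVec_add_mem_breakWindow p ha hb i)]

end Plane

section DiagramConfig

variable {Q S : Type} {M : RowAutomaton Q S} {p : ℕ}

theorem TileRule.congr {t t' : ℤ → ℤ → Option (Tile Q S)} (h : TileRule M t)
    (ht : ∀ a b : ℤ, a.natAbs ≤ 1 → b.natAbs ≤ 1 → t a b = t' a b) : TileRule M t' := by
  obtain ⟨h1, h2, h3, h4, h5, h6⟩ := h
  rw [ht 0 0 (by omega) (by omega)] at *
  rw [ht 1 0 (by omega) (by omega)] at *
  rw [ht 0 1 (by omega) (by omega)] at *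
  rw [ht (-1) 0 (by omega) (by omega)] at *
  rw [ht 0 (-1) (by omega) (by omega)] at *
  exact ⟨h1, h2, h3, h4, h5, h6⟩

theorem CellRule.congr {β β' : ℤ → ℤ → Prop} {c c' : ℤ → ℤ → Cell p Q S} (h : CellRule M p β c)
    (hp : 0 < p)
    (hβ : ∀ a b : ℤ, a.natAbs ≤ 2 * p → b.natAbs ≤ 2 * p → (β a b ↔ β' a b))
    (hc : ∀ a b : ℤ, a.natAbs ≤ 2 * p → b.natAbs ≤ 2 * p → c a b = c' a b) :
    CellRule M p β' c' := by
  obtain ⟨h1, h2, h3, h4, h5⟩ := h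
  have h5' : TileRule M fun a b => (c' a b).tile :=
    h5.congr fun a b ha hb => by rw [hc a b (by omega) (by omega)]
  rw [hc 0 0 (by omega) (by omega)] at h1 h2 h3 h4
  rw [hc p 0 (by omega) (by omega), hc (-p) 0 (by omega) (by omega),
    hc 0 p (by omega) (by omega), hc 0 (-p) (by omega) (by omega)] at h2
  rw [hc (-1) 0 (by omega) (by omega), hc 0 (-1) (by omega) (by omega)] at h3
  rw [hc 1 0 (by omega) (by omega), hc 0 (-1) (by omega) (by omega)] at h4
  rw [hβ 0 0 (by omega) (by omega)] at h1
  refine ⟨h1, fun h => (h2 h).imp_left ?_, h3, h4, h5'⟩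
  rintro ⟨a, b, hab, h⟩
  exact ⟨a, b, hab, (hβ a b (by omega) (by omega)).1 h⟩

variable {d : ℕ} {A : Type*}

/-- The configurations that consist of an arbitrary first layer and an auxiliary layer that obeys
the local rule over the breaks of the first layer and in which all diagrams start with the
input `n`. -/
structure IsDiagramConfig (M : RowAutomaton Q S) (p : ℕ) (i₀ i₁ : Fin d) (γ : Fin 4 → S) (n : ℕ)
    (x : (Fin d → ℤ) → A × Cell p Q S) : Prop where
  rule : ∀ v, CellRule M p (fun a b => IsBreak p (fun v => (x v).1) (v + planeVec i₀ i₁ a b))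
    fun a b => (x (v + planeVec i₀ i₁ a b)).2
  input : ∀ v, (x v).2.IsCorner → ∀ i ≤ n + 1, ∃ τ ∈ (x (v + Pi.single i₀ (i : ℤ))).2.tile,
    τ.bottom = true ∧ τ.sym = γ (inputDigit n i)

/-- The sets of configurations `IsDiagramConfig` are subshifts of finite type whose presentations
are computable from the input. -/
theorem exists_presentation [Finite Q] [Finite S] [Finite A] (hp : 0 < p) (i₀ i₁ : Fin d)
    (γ : Fin 4 → S) :
    ∃ (k : ℕ) (E : A × Cell p Q S ≃ Fin k) (L : ℕ → List (List ((Fin d → ℤ) × ℕ))),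
      Computable L ∧ ∀ (n : ℕ) (x : (Fin d → ℤ) → Fin k),
        x ∈ (SFTPresentation.toSubshift (k, L n)).carrier ↔
          IsDiagramConfig M p i₀ i₁ γ n fun v => E.symm (x v) := by
  classical
  obtain ⟨k, ⟨E⟩⟩ := Finite.exists_equiv_fin (A × Cell p Q S)
  obtain ⟨L₀, hL₀⟩ := exists_forbidden_list (k := k) (breakWindow i₀ i₁ p (2 * p))
    (fun x => CellRule M p
      (fun a b => IsBreak p (fun v => (E.symm (x v)).1) (planeVec i₀ i₁ a b))
      fun a b => (E.symm (x (planeVec i₀ i₁ a b))).2) (by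
    intro x x' h hx
    refine hx.congr hp (fun a b ha hb => ?_) fun a b ha hb => ?_
    · exact isBreak_congr (fun v hv => by simp only [h v hv]) ha hb
    · simp only [h _ (planeVec_mem_breakWindow p ha hb)])
  -- Pairs of a corner and a symbol that is not a bottom tile with the prescribed digit. Only the
  -- input patterns built from them depend on `n`.
  let bad : Fin 4 → List (ℕ × ℕ) := fun y =>
    ((Finset.univ : Finset (Fin k × Fin k)).filter fun s => (E.symm s.1).2.IsCorner ∧
      ¬ ∃ τ ∈ (E.symm s.2).2.tile, τ.bottom = true ∧ τ.sym = γ y).toList.map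
        fun s => (s.1.val, s.2.val)
  refine ⟨k, E, fun n => L₀ ++ inputPatterns i₀ bad n,
    (Primrec.list_append.comp (Primrec.const L₀) (primrec_inputPatterns i₀ bad)).to_comp,
    fun n x => ?_⟩
  have h1 : (∀ p ∈ inputPatterns i₀ bad n, ∀ u, ¬ PatternOccursAt p x u) ↔
      ∀ v, (E.symm (x v)).2.IsCorner → ∀ i ≤ n + 1,
        ∃ τ ∈ (E.symm (x (v + Pi.single i₀ (i : ℤ)))).2.tile,
          τ.bottom = true ∧ τ.sym = γ (inputDigit n i) := by
    constructor
    · intro h v hv i hi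
      by_contra hn
      refine h [(0, (x v).val), (Pi.single i₀ (i : ℤ), (x (v + Pi.single i₀ (i : ℤ))).val)] ?_ v ?_
      · refine List.mem_flatMap.2 ⟨i, List.mem_range.2 (by omega), List.mem_map.2
          ⟨((x v).val, (x (v + Pi.single i₀ (i : ℤ))).val), List.mem_map.2
            ⟨(x v, x (v + Pi.single i₀ (i : ℤ))), ?_, rfl⟩, rfl⟩⟩
        simp only [Finset.mem_toList, Finset.mem_filter, Finset.mem_univ, true_and]
        exact ⟨hv, hn⟩
      · simp [PatternOccursAt]
    · intro h p hp u hu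
      obtain ⟨i, hi, hp⟩ := List.mem_flatMap.1 hp
      obtain ⟨_, hbad, rfl⟩ := List.mem_map.1 hp
      obtain ⟨⟨s, s'⟩, hs, rfl⟩ := List.mem_map.1 hbad
      simp only [Finset.mem_toList, Finset.mem_filter, Finset.mem_univ, true_and] at hs
      have e1 : x u = s := Fin.ext (by simpa using hu (0, s.val) (by simp))
      have e2 : x (u + Pi.single i₀ (i : ℤ)) = s' :=
        Fin.ext (by simpa using hu (Pi.single i₀ (i : ℤ), s'.val) (by simp))
      refine hs.2 ?_
      rw [← e2]
      exact h u (by rw [e1]; exact hs.1) i (by have := List.mem_range.1 hi; omega)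
  have h2 := hL₀ x
  have hbreak : ∀ v a b, IsBreak p (fun w => (E.symm (x (v + w))).1) (planeVec i₀ i₁ a b) =
      IsBreak p (fun w => (E.symm (x w)).1) (v + planeVec i₀ i₁ a b) := fun v a b =>
    propext (isBreak_shift p (fun w => (E.symm (x w)).1) v _)
  simp only [shift_apply, hbreak] at h2
  change (∀ p ∈ L₀ ++ inputPatterns i₀ bad n, ∀ u, ¬ PatternOccursAt p x u) ↔ _
  simp only [List.mem_append, or_imp, forall_and]
  rw [h1]
  constructor
  · rintro ⟨h3, h4⟩
    refine ⟨fun v => ?_, h4⟩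
    exact h2.1 h3 v
  · rintro ⟨h3, h4⟩
    exact ⟨h2.2 h3, h4⟩

end DiagramConfig

/-! ### Strong periodicity -/

section StronglyPeriodic

variable {d : ℕ} {A : Type*}

theorem StronglyPeriodic.exists_period {x : (Fin d → ℤ) → A} (h : StronglyPeriodic x) :
    ∃ p : ℕ, 0 < p ∧ ∀ (i : Fin d) (v : Fin d → ℤ), x (v + Pi.single i (p : ℤ)) = x v := by
  have h1 : ∀ i : Fin d, ∃ p : ℕ, 0 < p ∧ ∀ v : Fin d → ℤ, x (v + Pi.single i (p : ℤ)) = x v := by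
    intro i
    have hni : ¬ Function.Injective fun n : ℕ => shift (Pi.single i (n : ℤ) : Fin d → ℤ) x :=
      fun hinj => Set.infinite_range_of_injective hinj
        (h.subset (Set.range_subset_iff.2 fun n => ⟨_, rfl⟩))
    have key : ∀ m n : ℕ, m < n → shift (Pi.single i (m : ℤ) : Fin d → ℤ) x =
        shift (Pi.single i (n : ℤ)) x →
        ∃ p : ℕ, 0 < p ∧ ∀ v : Fin d → ℤ, x (v + Pi.single i (p : ℤ)) = x v := by
      intro m n hmn heq
      refine ⟨n - m, by omega, fun v => ?_⟩
      have := congrFun heq (v - Pi.single i (m : ℤ))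
      simp only [shift_apply, add_sub_cancel] at this
      rw [this]
      congr 1
      rw [Nat.cast_sub hmn.le, Pi.single_sub]
      abel
    simp only [Function.Injective, not_forall] at hni
    obtain ⟨m, n, heq, hne⟩ := hni
    rcases Nat.lt_or_gt_of_ne hne with h | h
    · exact key m n h heq
    · exact key n m h heq.symm
  choose p hp hx using h1
  -- The product of the periods along the axes serves all axes at once.
  refine ⟨∏ i, p i, Finset.prod_pos fun i _ => hp i, fun i v => ?_⟩
  obtain ⟨k, hk⟩ := Finset.dvd_prod_of_mem p (Finset.mem_univ i)
  have hmul : ∀ (k : ℕ) (v : Fin d → ℤ), x (v + Pi.single i ((p i * k : ℕ) : ℤ)) = x v := by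
    intro k
    induction k with
    | zero => simp
    | succ k ih =>
      intro v
      rw [Nat.mul_succ, Nat.cast_add, Pi.single_add, ← add_assoc, hx, ih]
  rw [hk, hmul]

theorem stronglyPeriodic_of_period {x : (Fin d → ℤ) → A} {p : ℕ} (hp : 0 < p)
    (h : ∀ (i : Fin d) (v : Fin d → ℤ), x (v + Pi.single i (p : ℤ)) = x v) :
    StronglyPeriodic x := by
  have hint : ∀ (i : Fin d) (k : ℤ) (v : Fin d → ℤ), x (v + Pi.single i (p * k)) = x v := by
    intro i k
    induction k with
    | zero => simp
    | succ k ih =>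
      intro v
      rw [mul_add, mul_one, Pi.single_add, ← add_assoc, h, ih]
    | pred k ih =>
      intro v
      rw [mul_sub, mul_one, ← h i, add_assoc, ← Pi.single_add, sub_add_cancel, ih]
  have hvec : ∀ (s : Finset (Fin d)) (u v : Fin d → ℤ),
      x (v + ∑ i ∈ s, Pi.single i ((p : ℤ) * u i)) = x v := by
    classical
    intro s u
    induction s using Finset.induction_on with
    | empty => simp
    | insert i s hi ih =>
      intro v
      rw [Finset.sum_insert hi, ← add_assoc, ih, hint]
  refine Set.Finite.subset ((Set.finite_range fun u : Fin d → Fin p =>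
    shift (fun i => ((u i : ℕ) : ℤ)) x)) ?_
  rintro _ ⟨u, rfl⟩
  have hp' : (p : ℤ) ≠ 0 := by exact_mod_cast hp.ne'
  have hlt : ∀ i, (u i % p).toNat < p := fun i => by
    have h1 := Int.emod_nonneg (u i) hp'
    have h2 := Int.emod_lt_of_pos (u i) (by exact_mod_cast hp : (0 : ℤ) < p)
    omega
  refine ⟨fun i => ⟨_, hlt i⟩, ?_⟩
  ext v
  simp only [shift_apply]
  rw [← hvec Finset.univ (fun i => u i / p), Finset.univ_sum_single]
  congr 1
  ext i
  simp only [Pi.add_apply, Int.toNat_of_nonneg (Int.emod_nonneg (u i) hp')]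
  have := Int.emod_add_mul_ediv (u i) p
  omega

/-- A subshift that contains a configuration contains every strongly periodic configuration that
differs from it at finitely many positions only. -/
theorem mem_of_eq_off_finite [TopologicalSpace A] {Y : Subshift A (Fin d → ℤ)}
    (i₀ : Fin d) {y z : (Fin d → ℤ) → A} (hy : y ∈ Y.carrier) {C : Set (Fin d → ℤ)}
    (hC : C.Finite) (hyz : ∀ v, v ∉ C → y v = z v) {p : ℕ} (hp : 0 < p)
    (hz : ∀ v : Fin d → ℤ, z (v + Pi.single i₀ (p : ℤ)) = z v) : z ∈ Y.carrier := by
  have hzn : ∀ (n : ℕ) (v : Fin d → ℤ), z (v + Pi.single i₀ ((n : ℤ) * p)) = z v := by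
    intro n
    induction n with
    | zero => simp
    | succ n ih =>
      intro v
      rw [Nat.cast_succ, add_mul, one_mul, Pi.single_add, ← add_assoc, hz, ih]
  -- Shifts by multiples of `p` fix `z` and move `C` away from each position, so the shifts of `y`
  -- converge to `z`.
  refine Y.isClosed.mem_of_tendsto (b := Filter.atTop)
    (f := fun n : ℕ => shift (Pi.single i₀ ((n : ℤ) * p)) y) ?_
    (Filter.Eventually.of_forall fun n => Y.mapsTo _ hy)
  refine tendsto_pi_nhds.2 fun v => tendsto_const_nhds.congr' ?_
  have hinj : Function.Injective fun n : ℕ => (v + Pi.single i₀ ((n : ℤ) * p) : Fin d → ℤ) := by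
    intro m n hmn
    have := congrFun hmn i₀
    simpa [hp.ne'] using this
  have hfin := hC.preimage hinj.injOn
  rw [← Nat.cofinite_eq_atTop]
  filter_upwards [hfin.compl_mem_cofinite] with n hn
  rw [shift_apply, add_comm, hyz _ hn, hzn]

end StronglyPeriodic

/-! ### Correctness of the reduction -/

section Reduction

variable {d : ℕ} {A : Type*} [TopologicalSpace A] [DiscreteTopology A]
  {Q S : Type} {M : RowAutomaton Q S} {p : ℕ} {i₀ i₁ : Fin d} {γ : Fin 4 → S} {n k : ℕ}
  {Y : Subshift A (Fin d → ℤ)} {X : Subshift (Fin k) (Fin d → ℤ)}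
  {E : A × Cell p Q S ≃ Fin k}

/-- A map that depends on finitely many coordinates only is continuous. -/
theorem continuous_of_forall_mem_finset {ι β : Type*} [TopologicalSpace β] (D : Finset ι)
    (φ : (ι → A) → β) (h : ∀ x x' : ι → A, (∀ i ∈ D, x i = x' i) → φ x = φ x') :
    Continuous φ := by
  refine IsLocallyConstant.continuous ((IsLocallyConstant.iff_exists_open φ).2 fun x => ?_)
  exact ⟨cylinder D x, isOpen_cylinder D x, fun i _ => rfl, fun x' hx' => h x' x hx'⟩

/-- The embedding keeps `x` as its first layer, hence is injective on any `Y`; the second layer is a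
local function of the breaks of `x`. -/
theorem subshiftEmbeds_of_halts (hp : 0 < p) (hblank : γ 3 = M.blank) (hγ : γ.Injective)
    (hX : ∀ x, x ∈ X.carrier ↔ IsDiagramConfig M p i₀ i₁ γ n fun v => E.symm (x v))
    (h : M.Halts (M.start, fun i => γ (inputDigit n i))) : SubshiftEmbeds Y X := by
  obtain ⟨t, r, h0, hh, hs⟩ := h.exists_trace
  have hbound := RowAutomaton.exists_bound_of_trace hs (n := n + 1) (by
    intro i hi
    rw [h0, ← hblank]
    exact congrArg γ (inputDigit_of_lt hi))
  -- All rows are blank from column `n + 1 + t` on, so column `w - 1` is blank, and the prescribed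
  -- columns up to `n + 1` fit.
  let w := n + t + 2
  let R := n + t + 3
  have hw : w + 1 ≤ R := le_rfl
  have ht : t + 2 ≤ R := by omega
  have hT : ∀ B, TileRule M (tileLayer R B t w r) := fun B =>
    tileRule_tileLayer hw ht (by rw [h0]) hs hh (fun j hj i hi => hbound j hj i (by omega)) (by
      rw [h0]
      intro i hi
      simp only at hi ⊢
      rw [← hblank] at hi ⊢
      rw [inputDigit_succ (hγ hi)])
  let Φ : ((Fin d → ℤ) → A) → (Fin d → ℤ) → Cell p Q S := fun x v =>
    cellLayer R (fun a b => IsBreak p x (v + planeVec i₀ i₁ a b)) t w r p 0 0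
  have hΦ : ∀ x v a b, Φ x (v + planeVec i₀ i₁ a b) =
      cellLayer R (fun a b => IsBreak p x (v + planeVec i₀ i₁ a b)) t w r p a b := by
    intro x v a b
    have := cellLayer_viewFrom (R := R) (t := t) (w := w) (r := r) (p := p)
      (B := fun a b => IsBreak p x (v + planeVec i₀ i₁ a b)) a b 0 0
    simp only [add_zero] at this
    rw [← this]
    simp only [Φ, add_assoc, ← planeVec_add]
  have hshift : ∀ x u v, Φ (shift u x) v = Φ x (u + v) := by
    intro x u v
    simp only [Φ, isBreak_shift, add_assoc]
  have hmem : ∀ x, (fun v => E (x v, Φ x v)) ∈ X.carrier := by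
    intro x
    rw [hX]
    simp only [Equiv.symm_apply_apply]
    refine ⟨fun v => ?_, fun v hv i hi => ?_⟩
    · simp only [hΦ]
      exact cellRule_cellLayer hp (by omega) hw ht (hT _)
    · have := input_of_isCorner hw ht hv i (by omega)
      rw [← hΦ, h0] at this
      simpa [planeVec] using this
  have hcont : ∀ v, Continuous fun x => E (x v, Φ x v) := by
    intro v
    have h1 : Continuous fun x => E (x 0, Φ x 0) := by
      refine continuous_of_forall_mem_finset (breakWindow i₀ i₁ p (3 * R + 1)) _ fun x x' h => ?_
      have hmem0 : planeVec i₀ i₁ 0 0 ∈ breakWindow i₀ i₁ p (3 * R + 1) :=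
        planeVec_mem_breakWindow p (by simp) (by simp)
      rw [planeVec_zero_zero] at hmem0
      rw [h 0 hmem0]
      congr 2
      refine cellLayer_congr hw ht fun a b ha hb => ?_
      simp only [zero_add]
      exact isBreak_congr h ha hb
    have h2 := h1.comp (continuous_shift (A := A) v)
    simpa [Function.comp_def, hshift] using h2
  refine ⟨fun y => ⟨fun v => E (y.1 v, Φ y.1 v), hmem y.1⟩, ⟨?_, ?_⟩, ?_⟩
  · exact Continuous.subtype_mk (continuous_pi fun v => (hcont v).comp continuous_subtype_val) _
  · intro u y
    ext v
    simp [hshift]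
  · intro y y' hyy
    ext v
    have := congrFun (congrArg Subtype.val hyy) v
    simpa using congrArg Prod.fst (E.injective this)

omit [DiscreteTopology A] in
/-- Morphisms map a configuration that agrees with a strongly periodic one off a finite set to a
configuration with the same property. -/
theorem IsSubshiftMorphism.finite_ne {F : Y.carrier → X.carrier} (hF : IsSubshiftMorphism Y X F)
    {y z : Y.carrier} {C : Set (Fin d → ℤ)} (hC : C.Finite) (hyz : ∀ v, v ∉ C → y.1 v = z.1 v)
    (hz : StronglyPeriodic z.1) : {v | (F y).1 v ≠ (F z).1 v}.Finite := by
  have hval : ∀ (x : Y.carrier) (v : Fin d → ℤ),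
      (F x).1 v = (F ⟨shift v x.1, Y.mapsTo v x.2⟩).1 0 := by
    intro x v
    rw [hF.2]
    simp
  have hloc : ∀ x : Y.carrier, ∃ D : Finset (Fin d → ℤ), ∀ x' : Y.carrier,
      (∀ v ∈ D, x'.1 v = x.1 v) → (F x').1 0 = (F x).1 0 := by
    intro x
    have hc : Continuous fun x : Y.carrier => (F x).1 0 :=
      (continuous_apply 0).comp (continuous_subtype_val.comp hF.1)
    have ho := (isOpen_discrete {(F x).1 0}).preimage hc
    obtain ⟨U, hU, hUeq⟩ := isOpen_induced_iff.1 ho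
    have hxU : x.1 ∈ U := by
      have : x ∈ Subtype.val ⁻¹' U := by rw [hUeq]; rfl
      exact this
    obtain ⟨D, u, hu, hDU⟩ := isOpen_pi_iff.1 hU x.1 hxU
    refine ⟨D, fun x' hx' => ?_⟩
    have : x' ∈ Subtype.val ⁻¹' U := hDU fun v hv => by
      rw [hx' v hv]
      exact (hu v hv).2
    rw [hUeq] at this
    exact this
  -- The window depends on the point, but `z` has only finitely many shifts, so finitely many
  -- windows matter.
  choose D hD using hloc
  have hfin : (Set.range fun v : Fin d → ℤ => (⟨shift v z.1, Y.mapsTo v z.2⟩ : Y.carrier)).Finite := by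
    refine Set.Finite.of_finite_image (f := Subtype.val) (Set.Finite.subset hz ?_)
      Subtype.val_injective.injOn
    rintro _ ⟨_, ⟨v, rfl⟩, rfl⟩
    exact ⟨v, rfl⟩
  have hbig : (⋃ x ∈ Set.range fun v : Fin d → ℤ => (⟨shift v z.1, Y.mapsTo v z.2⟩ : Y.carrier),
      Set.image2 (fun c e => c - e) C (D x : Set (Fin d → ℤ))).Finite :=
    hfin.biUnion fun x _ => hC.image2 _ (D x).finite_toSet
  refine hbig.subset fun v hv => ?_
  by_contra hn
  refine hv ?_
  rw [hval y, hval z]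
  refine hD _ _ fun e he => hyz _ fun hmem => hn ?_
  exact Set.mem_biUnion ⟨v, rfl⟩ ⟨v + e, hmem, e, he, by simp⟩

omit [DiscreteTopology A] in
theorem halts_of_subshiftEmbeds (hi : i₀ ≠ i₁) (hp : 0 < p) (hblank : γ 3 = M.blank)
    (hX : ∀ x, x ∈ X.carrier ↔ IsDiagramConfig M p i₀ i₁ γ n fun v => E.symm (x v))
    {y z : (Fin d → ℤ) → A} (hy : y ∈ Y.carrier) (hyp : ¬ StronglyPeriodic y)
    {C : Set (Fin d → ℤ)} (hC : C.Finite) (hyz : ∀ v, v ∉ C → y v = z v)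
    (hz : ∀ (i : Fin d) (v : Fin d → ℤ), z (v + Pi.single i (p : ℤ)) = z v)
    (h : SubshiftEmbeds Y X) : M.Halts (M.start, fun i => γ (inputDigit n i)) := by
  obtain ⟨F, hF, hinj⟩ := h
  have hzY : z ∈ Y.carrier := mem_of_eq_off_finite i₀ hy hC hyz hp (hz i₀)
  have hfin := hF.finite_ne (y := ⟨y, hy⟩) (z := ⟨z, hzY⟩) hC hyz (stronglyPeriodic_of_period hp hz)
  set fy := F ⟨y, hy⟩
  set fz := F ⟨z, hzY⟩
  have hDy := (hX fy.1).1 fy.2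
  have hDz := (hX fz.1).1 fz.2
  have he0 := planeVec_zero_zero i₀ i₁
  have hper : ∀ (i : Fin d) (v : Fin d → ℤ), fz.1 (v + Pi.single i (p : ℤ)) = fz.1 v := by
    intro i v
    have h1 : (⟨shift (Pi.single i (p : ℤ)) z, Y.mapsTo _ hzY⟩ : Y.carrier) = ⟨z, hzY⟩ :=
      Subtype.ext (funext fun u => (congrArg z (add_comm _ _)).trans (hz i u))
    have h2 := hF.2 (Pi.single i (p : ℤ)) ⟨z, hzY⟩
    rw [h1] at h2
    have h3 := congrFun (congrArg Subtype.val h2) v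
    rw [add_comm]
    exact h3.symm
  -- The image of `z` has no breaks and agrees with its translates by `p`, so both alternatives of
  -- `aperiodic` fail at a nonblank cell.
  have hzblank : ∀ v, (E.symm (fz.1 v)).2 = none := by
    intro v
    by_contra hne
    have hneg : ∀ (i : Fin d) (v : Fin d → ℤ), fz.1 (v + Pi.single i (-p : ℤ)) = fz.1 v := by
      intro i v
      rw [← hper i, add_assoc, ← Pi.single_add, neg_add_cancel, Pi.single_zero, add_zero]
    rcases (hDz.rule v).aperiodic (by simpa [he0] using hne) with ⟨a, b, -, i, hb⟩ | hb
    · simp [hper] at hb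
    · simp [planeVec, hper, hneg] at hb
  have hyfin : {v | (E.symm (fy.1 v)).2 ≠ none}.Finite := by
    refine hfin.subset fun v hv heq => hv ?_
    rw [heq]
    exact hzblank v
  refine RowAutomaton.halts_of_finite (e := planeVec i₀ i₁) (planeVec_add i₀ i₁)
    (f₁ := fun v => v i₀) (f₂ := fun v => v i₁) (by simp [planeVec, hi])
    (by simp [planeVec, hi.symm]) hDy.rule hyfin ?_ (n := n) ?_ ?_
  · by_contra! hall
    refine hyp (stronglyPeriodic_of_period hp fun i v => ?_)
    have hcell : ∀ v, fy.1 (v + Pi.single i (p : ℤ)) = fy.1 v := by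
      intro v
      have h1 := (hDy.rule v).not_break (by simpa [he0] using hall v)
      simp only [IsBreak, he0, add_zero, not_exists, not_not] at h1
      exact E.symm.injective (Prod.ext (h1 i) ((hall _).trans (hall _).symm))
    have h2 : (⟨shift (Pi.single i (p : ℤ)) y, Y.mapsTo _ hy⟩ : Y.carrier) = ⟨y, hy⟩ := by
      refine hinj ((hF.2 (Pi.single i (p : ℤ)) ⟨y, hy⟩).trans ?_)
      exact Subtype.ext (funext fun u => (congrArg fy.1 (add_comm _ _)).trans (hcell u))
    have h3 := congrFun (congrArg Subtype.val h2) v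
    rw [add_comm]
    exact h3
  · intro i hi
    rw [← hblank]
    exact congrArg γ (inputDigit_of_lt hi)
  · intro v hv k hk
    simpa [planeVec] using hDy.input v hv k hk

end Reduction

theorem mainTheorem4 (d : ℕ) (hd : 2 ≤ d) {A : Type*} [Finite A] [TopologicalSpace A]
    [DiscreteTopology A] (Y : Subshift A (Fin d → ℤ))
    (hY : ∃ y ∈ Y.carrier, ¬ StronglyPeriodic y ∧ StronglyPeriodicOutsideFinite y) :
    IsSigmaZeroOneHard (EmbeddingProblem Y) := by
  obtain ⟨y, hy, hyp, C, hC, z, hz, hyz⟩ := hY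
  obtain ⟨p, hp, hper⟩ := hz.exists_period
  intro P hP
  obtain ⟨Q, S, _, _, M, γ, hγ, hblank, hM⟩ := hP.exists_rowAutomaton
  let i₀ : Fin d := ⟨0, by omega⟩
  let i₁ : Fin d := ⟨1, by omega⟩
  have hi : i₀ ≠ i₁ := by simp [i₀, i₁]
  obtain ⟨k, E, L, hL, hX⟩ := exists_presentation (M := M) (A := A) hp i₀ i₁ γ
  refine ⟨fun n => (k, L n), (Computable.const k).pair hL, fun n => ?_⟩
  rw [hM]
  exact ⟨fun h => subshiftEmbeds_of_halts hp hblank hγ (hX n) h,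
    fun h => halts_of_subshiftEmbeds hi hp hblank (hX n) hy hyp hC hyz hper h⟩
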